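/- For $s\in\mathbb C$, real $x>0$ and $0\le q<1$ let $$\mathscr L_q(s,x)=\sum_{k=1}^\infty\frac{k^s q^{kx}}{1-q^k},$$ which converges. Let $\zeta(s)$ be the Riemann zeta function, $\zeta(s,x)$ the Hurwitz zeta function (the analytic continuation in $s$ of $\sum_{n\ge 0}(n+x)^{-s}$), $\zeta'(s,x)=\partial_s\zeta(s,x)$, $\psi=\Gamma'/\Gamma$, $B_k(x)$ the Bernoulli polynomials, given by $\frac{te^{xt}}{e^t-1}=\sum_{k\ge0}\frac{B_k(x)}{k!}t^k$, and $H_n=\sum_{j=1}^n \frac1j$ (so $H_0=0$). Fix $x>0$. Then $\mathscr L_q(s,x)$ has the following complete asymptotic expansions as $q\to1^-$. 1. If $s\in\mathbb C\setminus\{0,-1,-2,\dots\}$, then for every integer $N\ge0$ $$\mathscr L_q(s,x)=\frac{\Gamma(1+s)\,\zeta(1+s,x)}{(\log\frac1q)^{1+s}}-\sum_{k=0}^{N-1}\frac{\zeta(1-s-k)}{k!}B_k(x)(\log q)^{k-1}+O\big(|\log q|^{N-1}\big).$$ 2. If $s=0$, then for every integer $N\ge1$ $$\mathscr L_q(0,x)=\frac{\psi(x)+\log\log\frac1q}{\log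 q}-\sum_{k=1}^{N-1}\frac{\zeta(1-k)}{k!}B_k(x)(\log q)^{k-1}+O\big(|\log q|^{N-1}\big).$$ 3. If $s=-m$ with an integer $m\ge1$, then for every integer $N\ge0$ $$\mathscr L_q(-m,x)=\Big[m\,\zeta'(1-m,x)+\Big(\log\log\tfrac1q-H_{m-1}\Big)B_m(x)\Big]\frac{(\log q)^{m-1}}{m!}-\sum_{\substack{0\le k\le N-1\\ k\ne m}}\frac{\zeta(1+m-k)}{k!}B_k(x)(\log q)^{k-1}+O\big(|\log q|^{N-1}\big).$$ The implied constants may depend on $s$ (respectively $m$), $x$ and $N$. -/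

import Mathlib

open Filter Topology Asymptotics

/-- The `k`-th term (`k = 0` corresponds to the summation index `1`) of the Lambert series
`∑_{k ≥ 1} k ^ s * q ^ (k x) / (1 - q ^ k)`. -/
noncomputable def lambertTerm (q : ℝ) (s : ℂ) (x : ℝ) (k : ℕ) : ℂ :=
  ((k + 1 : ℕ) : ℂ) ^ s * ((q ^ (((k + 1 : ℕ) : ℝ) * x) : ℝ) : ℂ) / (1 - (q : ℂ) ^ (k + 1))

/-- The Lambert series `𝓛_q(s, x) = ∑_{k ≥ 1} k ^ s * q ^ (k x) / (1 - q ^ k)`. -/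
noncomputable def lambertSeries (q : ℝ) (s : ℂ) (x : ℝ) : ℂ :=
  ∑' k : ℕ, lambertTerm q s x k

/-- The (analytically continued) Hurwitz zeta function `ζ(s, x)`, as a function of `s`, for every
real `x > 0`. Mathlib's `HurwitzZeta.hurwitzZeta` has the parameter in `ℝ / ℤ` and is `ζ(s, y)` for
the representative `y ∈ (0, 1]`; the terms `(x - 1) ^ (-s), (x - 2) ^ (-s), …, y ^ (-s)` are removed
here. The two theorems below show that this is the analytic continuation to `s ≠ 1` of
`∑_{n ≥ 0} (n + x) ^ (-s)`. -/
noncomputable def hurwitzZetaPos (x : ℝ) (s : ℂ) : ℂ :=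
  HurwitzZeta.hurwitzZeta (x : UnitAddCircle) s
    - ∑ n ∈ Finset.range (⌈x⌉₊ - 1), ((x - ((n : ℝ) + 1) : ℝ) : ℂ) ^ (-s)

theorem hasSum_hurwitzZetaPos {x : ℝ} (hx : 0 < x) {s : ℂ} (hs : 1 < s.re) :
    HasSum (fun n : ℕ => 1 / (((n : ℝ) + x : ℝ) : ℂ) ^ s) (hurwitzZetaPos x s) := by
  obtain ⟨N, hN⟩ : ∃ N : ℕ, ⌈x⌉₊ = N + 1 :=
    ⟨⌈x⌉₊ - 1, by have := Nat.ceil_pos.mpr hx; omega⟩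
  have h1 : (N : ℝ) < x := by
    have : N < ⌈x⌉₊ := by omega
    exact Nat.lt_ceil.mp this
  have h2 : x ≤ N + 1 := by
    have := Nat.le_ceil x
    rw [hN] at this
    exact_mod_cast this
  have hy : x - N ∈ Set.Icc (0 : ℝ) 1 := ⟨by linarith, by linarith⟩
  have key := HurwitzZeta.hasSum_hurwitzZeta_of_one_lt_re hy hs
  have hc : ((x - N : ℝ) : UnitAddCircle) = (x : UnitAddCircle) := by
    have h := AddCircle.coe_add_period (1 : ℝ) (x - N)
    have : ∀ k : ℕ, ((x - k : ℝ) : UnitAddCircle) = (x : UnitAddCircle) := by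
      intro k
      induction k with
      | zero => simp
      | succ k ih =>
        rw [← ih, ← AddCircle.coe_add_period (1 : ℝ) (x - (k + 1 : ℕ))]
        congr 1
        push_cast
        ring
    exact this N
  rw [hc] at key
  have h3 := (hasSum_nat_add_iff' N).mpr key
  unfold hurwitzZetaPos
  rw [hN, Nat.add_sub_cancel]
  have e1 : ∀ n : ℕ, (1 : ℂ) / (((n : ℝ) + x : ℝ) : ℂ) ^ s
      = 1 / (((n + N : ℕ) : ℂ) + ((x - N : ℝ) : ℂ)) ^ s := by
    intro n
    have : (((n : ℝ) + x : ℝ) : ℂ) = ((n + N : ℕ) : ℂ) + ((x - N : ℝ) : ℂ) := by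
      push_cast
      ring
    rw [this]
  have e2 : ∑ n ∈ Finset.range N, ((x - ((n : ℝ) + 1) : ℝ) : ℂ) ^ (-s)
      = ∑ i ∈ Finset.range N, 1 / ((i : ℂ) + ((x - N : ℝ) : ℂ)) ^ s := by
    rw [← Finset.sum_range_reflect]
    refine Finset.sum_congr rfl fun n hn => ?_
    have hn' := Finset.mem_range.mp hn
    have h4 : ((N - 1 - n : ℕ) : ℝ) = N - 1 - n := by
      rw [Nat.sub_sub, Nat.cast_sub (by omega)]
      push_cast
      ring
    have h5 : ((x - (((N - 1 - n : ℕ) : ℝ) + 1) : ℝ) : ℂ) = (n : ℂ) + ((x - N : ℝ) : ℂ) := by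
      rw [h4]
      push_cast
      ring
    rw [h5, Complex.cpow_neg, one_div]
  rw [e2]
  simp_rw [e1]
  exact h3

theorem differentiableAt_hurwitzZetaPos {x : ℝ} {s : ℂ} (hs : s ≠ 1) :
    DifferentiableAt ℂ (hurwitzZetaPos x) s := by
  unfold hurwitzZetaPos
  refine (HurwitzZeta.differentiableAt_hurwitzZeta _ hs).sub (DifferentiableAt.fun_sum ?_)
  intro n hn
  refine DifferentiableAt.const_cpow (by fun_prop) (Or.inl ?_)
  have hn' : n + 1 < ⌈x⌉₊ := by
    have := Finset.mem_range.mp hn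
    omega
  have h1 : ((n + 1 : ℕ) : ℝ) < x := Nat.lt_ceil.mp hn'
  push_cast at h1
  exact Complex.ofReal_ne_zero.mpr (by linarith)

/-! Put `q = exp (-t)`, so that `t → 0+`. Expanding the geometric series turns the Lambert series
into a double sum of `k ^ s * exp (-k (n + x) t)` over `k ≥ 1`, `n ≥ 0`. Its Mellin transform, after
multiplication by `t`, is `Γ(w + 1) ζ(w + 1, x) ζ(w + 1 - s)`. The poles of this product predict the
expansion: `w = s` gives the leading term and `w = -k` gives the term `t ^ k`. When `s = -m` two
poles merge into a double pole, which produces the logarithm.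

The inverse Mellin transform, with its need for vertical decay estimates, is avoided by separating
existence from identification. Existence is a real-variable argument:
`powLogExpansion_id_mul_lambertExp` shows that `t * lambertExp s x t` has some expansion `(α + β log
t) t ^ (-s) + ∑ c i t ^ i + O(t ^ N)`. For `∑ k ^ S exp (-k t)` with `Re S` large, Poisson summation
(`polylogExp_poisson_bound`) isolates `Γ(1 + S) t ^ (-(1 + S))`. Integrating in `t` lowers the
exponent to arbitrary `s`. Repeated integration by parts in `x` (`exists_lambertExp_byParts`), in
the manner of Euler–Maclaurin, reduces the Lambert series to such sums plus a remainder with large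
exponent, controlled by `lambertExp_leading`.

Identification: an expansion at `0` determines the polar part of the Mellin transform
(`mellin_of_expansion`), and the identity theorem compares it with the explicit product
(`expansion_coeff_lambertExp`). What is left is local: `ζ(-k, x) = -B_{k+1}(x) / (k + 1)`, the
constant term `-ψ(x)` of `ζ(v, x)` at `v = 1`, and the Laurent coefficients of `Γ` at its poles.
Euler's constant cancels between `Γ` and `ζ`. -/

/-! ### Convergence, regularity and decay of the series -/

theorem summable_rpow_mul_exp (σ : ℝ) {c : ℝ} (hc : 0 < c) :
    Summable fun k : ℕ => ((k + 1 : ℕ) : ℝ) ^ σ * Real.exp (-((k + 1 : ℕ) : ℝ) * c) := by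
  have h := (summable_nat_add_iff 1).mpr (Real.summable_pow_mul_exp_neg_nat_mul ⌈σ⌉₊ hc)
  refine Summable.of_nonneg_of_le (fun k => by positivity) (fun k => ?_) h
  have h1 : (1 : ℝ) ≤ ((k + 1 : ℕ) : ℝ) := by exact_mod_cast Nat.le_add_left 1 k
  have h2 : ((k + 1 : ℕ) : ℝ) ^ σ ≤ ((k + 1 : ℕ) : ℝ) ^ ⌈σ⌉₊ := by
    rw [← Real.rpow_natCast]
    exact Real.rpow_le_rpow_of_exponent_le h1 (Nat.le_ceil σ)
  rw [show -((k + 1 : ℕ) : ℝ) * c = -c * ((k + 1 : ℕ) : ℝ) by ring]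
  gcongr

theorem norm_natCast_succ_cpow (k : ℕ) (s : ℂ) :
    ‖((k + 1 : ℕ) : ℂ) ^ s‖ = ((k + 1 : ℕ) : ℝ) ^ s.re :=
  Complex.norm_natCast_cpow_of_pos k.succ_pos s

theorem natCast_succ_cpow_add_one (k : ℕ) (s : ℂ) :
    ((k + 1 : ℕ) : ℂ) ^ (s + 1) = ((k + 1 : ℕ) : ℂ) ^ s * ((k + 1 : ℕ) : ℂ) := by
  rw [Complex.cpow_add _ _ (by exact_mod_cast k.succ_ne_zero), Complex.cpow_one]

/-- The series `∑_{k ≥ 1} k ^ s * exp (-k t)`. -/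
noncomputable def polylogExp (s : ℂ) (t : ℝ) : ℂ :=
  ∑' k : ℕ, ((k + 1 : ℕ) : ℂ) ^ s * (Real.exp (-((k + 1 : ℕ) : ℝ) * t) : ℂ)

/-- The weight `exp (-k x t) / (1 - exp (-k t))`. -/
noncomputable def lambertWeight (k : ℕ) (x t : ℝ) : ℝ :=
  Real.exp (-((k + 1 : ℕ) : ℝ) * (x * t)) / (1 - Real.exp (-((k + 1 : ℕ) : ℝ) * t))

/-- The Lambert series at `q = exp (-t)`. -/
noncomputable def lambertExp (s : ℂ) (x t : ℝ) : ℂ :=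
  ∑' k : ℕ, ((k + 1 : ℕ) : ℂ) ^ s * (lambertWeight k x t : ℂ)

theorem norm_polylogExp_term (s : ℂ) (t : ℝ) (k : ℕ) :
    ‖((k + 1 : ℕ) : ℂ) ^ s * (Real.exp (-((k + 1 : ℕ) : ℝ) * t) : ℂ)‖
      = ((k + 1 : ℕ) : ℝ) ^ s.re * Real.exp (-((k + 1 : ℕ) : ℝ) * t) := by
  rw [norm_mul, norm_natCast_succ_cpow, Complex.norm_real, Real.norm_of_nonneg (Real.exp_pos _).le]

theorem summable_polylogExp (s : ℂ) {t : ℝ} (ht : 0 < t) :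
    Summable fun k : ℕ => ((k + 1 : ℕ) : ℂ) ^ s * (Real.exp (-((k + 1 : ℕ) : ℝ) * t) : ℂ) := by
  refine Summable.of_norm ?_
  simp_rw [norm_polylogExp_term]
  exact summable_rpow_mul_exp s.re ht

theorem hasDerivAt_polylogExp (s : ℂ) {t : ℝ} (ht : 0 < t) :
    HasDerivAt (polylogExp s) (-polylogExp (s + 1) t) t := by
  have key := hasDerivAt_tsum_of_isPreconnected
    (g := fun (k : ℕ) (y : ℝ) => ((k + 1 : ℕ) : ℂ) ^ s * (Real.exp (-((k + 1 : ℕ) : ℝ) * y) : ℂ))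
    (g' := fun (k : ℕ) (y : ℝ) =>
      -(((k + 1 : ℕ) : ℂ) ^ (s + 1) * (Real.exp (-((k + 1 : ℕ) : ℝ) * y) : ℂ)))
    (summable_rpow_mul_exp (s + 1).re (half_pos ht)) (isOpen_Ioi (a := t / 2)) isPreconnected_Ioi
    (fun k y _ => ?_) (fun k y hy => ?_) (half_lt_self ht) (summable_polylogExp s ht)
    (half_lt_self ht)
  · rw [tsum_neg] at key
    exact key
  · have h1 : HasDerivAt (fun y : ℝ => Real.exp (-((k + 1 : ℕ) : ℝ) * y))
        (Real.exp (-((k + 1 : ℕ) : ℝ) * y) * (-((k + 1 : ℕ) : ℝ) * 1)) y :=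
      ((hasDerivAt_id y).const_mul _).exp
    refine (h1.ofReal_comp.const_mul (((k + 1 : ℕ) : ℂ) ^ s)).congr_deriv ?_
    rw [natCast_succ_cpow_add_one]
    push_cast
    ring
  · rw [norm_neg, norm_polylogExp_term]
    have hy' : t / 2 < y := hy
    gcongr ?_ * Real.exp ?_
    simp only [neg_mul, neg_le_neg_iff]
    gcongr

/-- Since `k + 1 ≥ 1`, the denominator is at least `1 - exp (-a)`; the bound is uniform in `k` and
in `t ≥ a`, which makes it usable for every dominated-convergence argument below. -/
theorem lambertWeight_bound (k : ℕ) (x : ℝ) {a t : ℝ} (ha : 0 < a) (hat : a ≤ t) :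
    ‖lambertWeight k x t‖
      ≤ Real.exp (-((k + 1 : ℕ) : ℝ) * (x * t)) * (1 - Real.exp (-a))⁻¹ := by
  have h1 : (1 : ℝ) ≤ ((k + 1 : ℕ) : ℝ) := by exact_mod_cast Nat.le_add_left 1 k
  have h2 : Real.exp (-((k + 1 : ℕ) : ℝ) * t) ≤ Real.exp (-a) := by
    apply Real.exp_le_exp.mpr
    nlinarith
  have h3 : Real.exp (-a) < 1 := Real.exp_lt_one_iff.mpr (by linarith)
  rw [lambertWeight, Real.norm_of_nonneg (div_nonneg (Real.exp_pos _).le (by linarith)),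
    div_eq_mul_inv]
  gcongr

theorem norm_lambertExp_term_le (s : ℂ) (k : ℕ) (x : ℝ) {a t : ℝ} (ha : 0 < a) (hat : a ≤ t) :
    ‖((k + 1 : ℕ) : ℂ) ^ s * (lambertWeight k x t : ℂ)‖
      ≤ ((k + 1 : ℕ) : ℝ) ^ s.re * Real.exp (-((k + 1 : ℕ) : ℝ) * (x * t))
        * (1 - Real.exp (-a))⁻¹ := by
  rw [norm_mul, norm_natCast_succ_cpow, Complex.norm_real, mul_assoc]
  gcongr
  exact lambertWeight_bound k x ha hat

theorem summable_lambertExp (s : ℂ) {x t : ℝ} (hx : 0 < x) (ht : 0 < t) :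
    Summable fun k : ℕ => ((k + 1 : ℕ) : ℂ) ^ s * (lambertWeight k x t : ℂ) :=
  Summable.of_norm_bounded
    ((summable_rpow_mul_exp s.re (mul_pos hx ht)).mul_right (1 - Real.exp (-t))⁻¹)
    (fun k => norm_lambertExp_term_le s k x ht le_rfl)

theorem hasDerivAt_lambertExp (s : ℂ) {x t : ℝ} (hx : 0 < x) (ht : 0 < t) :
    HasDerivAt (fun y => lambertExp s y t) (-(t * lambertExp (s + 1) x t)) x := by
  have key := hasDerivAt_tsum_of_isPreconnected
    (g := fun (k : ℕ) (y : ℝ) => ((k + 1 : ℕ) : ℂ) ^ s * (lambertWeight k y t : ℂ))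
    (g' := fun (k : ℕ) (y : ℝ) =>
      -(t * (((k + 1 : ℕ) : ℂ) ^ (s + 1) * (lambertWeight k y t : ℂ))))
    (((summable_rpow_mul_exp (s + 1).re (mul_pos (half_pos hx) ht)).mul_right
      (1 - Real.exp (-t))⁻¹).mul_left t) (isOpen_Ioi (a := x / 2)) isPreconnected_Ioi
    (fun k y _ => ?_) (fun k y hy => ?_) (half_lt_self hx) (summable_lambertExp s hx ht)
    (half_lt_self hx)
  · rw [tsum_neg, tsum_mul_left] at key
    exact key
  · have h1 : HasDerivAt (fun y : ℝ => lambertWeight k y t)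
        (Real.exp (-((k + 1 : ℕ) : ℝ) * (y * t)) * (-((k + 1 : ℕ) : ℝ) * (1 * t))
          / (1 - Real.exp (-((k + 1 : ℕ) : ℝ) * t))) y :=
      ((((hasDerivAt_id y).mul_const t).const_mul _).exp).div_const _
    refine (h1.ofReal_comp.const_mul (((k + 1 : ℕ) : ℂ) ^ s)).congr_deriv ?_
    rw [natCast_succ_cpow_add_one, lambertWeight]
    push_cast
    ring
  · rw [norm_neg, norm_mul, Complex.norm_real, Real.norm_of_nonneg ht.le]
    have hy' : x / 2 < y := hy
    refine mul_le_mul_of_nonneg_left ((norm_lambertExp_term_le _ k y ht le_rfl).trans ?_) ht.le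
    have h3 : Real.exp (-t) < 1 := Real.exp_lt_one_iff.mpr (by linarith)
    have h4 : 0 ≤ (1 - Real.exp (-t))⁻¹ := inv_nonneg.mpr (by linarith)
    gcongr ?_ * Real.exp ?_ * _
    simp only [neg_mul, neg_le_neg_iff]
    gcongr

theorem continuousOn_lambertExp (s : ℂ) {x : ℝ} (hx : 0 < x) :
    ContinuousOn (lambertExp s x) (Set.Ioi 0) := by
  intro t ht
  have ht' : 0 < t := ht
  refine ContinuousAt.continuousWithinAt ?_
  have key : ContinuousOn (lambertExp s x) (Set.Ioi (t / 2)) := by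
    refine continuousOn_tsum (fun k => ?_)
      ((summable_rpow_mul_exp s.re (mul_pos hx (half_pos ht'))).mul_right
        (1 - Real.exp (-(t / 2)))⁻¹) (fun k y hy => ?_)
    · refine continuousOn_const.mul (Complex.continuous_ofReal.comp_continuousOn ?_)
      refine ContinuousOn.div (by fun_prop) (by fun_prop) (fun y hy => ?_)
      have hy' : t / 2 < y := hy
      have : Real.exp (-((k + 1 : ℕ) : ℝ) * y) < 1 := by
        apply Real.exp_lt_one_iff.mpr
        have : 0 < ((k + 1 : ℕ) : ℝ) * y := by
          have : 0 < y := by linarith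
          positivity
        linarith
      linarith
    · have hy' : t / 2 < y := hy
      refine (norm_lambertExp_term_le s k x (half_pos ht') hy'.le).trans ?_
      have h3 : Real.exp (-(t / 2)) < 1 := Real.exp_lt_one_iff.mpr (by linarith)
      have h4 : 0 ≤ (1 - Real.exp (-(t / 2)))⁻¹ := inv_nonneg.mpr (by linarith)
      gcongr ?_ * Real.exp ?_ * _
      simp only [neg_mul, neg_le_neg_iff]
      gcongr
  exact key.continuousAt (Ioi_mem_nhds (half_lt_self ht'))

theorem lambertExp_isBigO_atTop (s : ℂ) {x : ℝ} (hx : 0 < x) :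
    lambertExp s x =O[atTop] fun t => Real.exp (-x / 2 * t) := by
  have hS := (summable_rpow_mul_exp s.re (half_pos hx)).mul_right (1 - Real.exp (-1))⁻¹
  refine IsBigO.of_bound (∑' k : ℕ, ((k + 1 : ℕ) : ℝ) ^ s.re
    * Real.exp (-((k + 1 : ℕ) : ℝ) * (x / 2)) * (1 - Real.exp (-1))⁻¹) ?_
  filter_upwards [eventually_ge_atTop 1] with t ht
  rw [Real.norm_of_nonneg (Real.exp_pos _).le, ← tsum_mul_right]
  have h3 : Real.exp (-1) < 1 := Real.exp_lt_one_iff.mpr (by norm_num)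
  have h4 : 0 ≤ (1 - Real.exp (-1))⁻¹ := inv_nonneg.mpr (by linarith)
  refine tsum_of_norm_bounded (hS.mul_right _).hasSum fun k => ?_
  refine (norm_lambertExp_term_le s k x one_pos ht).trans ?_
  have h1 : (1 : ℝ) ≤ ((k + 1 : ℕ) : ℝ) := by exact_mod_cast Nat.le_add_left 1 k
  -- For `K = k + 1 ≥ 1` and `t ≥ 1` one has `2 K t ≥ K + t`: half of the exponent keeps the sum
  -- over `k` convergent, the other half gives the decay in `t`.
  have h5 : Real.exp (-((k + 1 : ℕ) : ℝ) * (x * t))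
      ≤ Real.exp (-((k + 1 : ℕ) : ℝ) * (x / 2)) * Real.exp (-x / 2 * t) := by
    rw [← Real.exp_add]
    apply Real.exp_le_exp.mpr
    have : 0 ≤ x * ((((k + 1 : ℕ) : ℝ) - 1) * t + ((k + 1 : ℕ) : ℝ) * (t - 1)) :=
      mul_nonneg hx.le (add_nonneg (mul_nonneg (by linarith) (by linarith))
        (mul_nonneg (by linarith) (by linarith)))
    nlinarith
  calc _ ≤ ((k + 1 : ℕ) : ℝ) ^ s.re * (Real.exp (-((k + 1 : ℕ) : ℝ) * (x / 2))
        * Real.exp (-x / 2 * t)) * (1 - Real.exp (-1))⁻¹ := by gcongr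
    _ = _ := by ring

/-! ### The difference equation in `x` and the double series -/

theorem lambertExp_sub_lambertExp_add_one (s : ℂ) {x t : ℝ} (hx : 0 < x) (ht : 0 < t) :
    lambertExp s x t - lambertExp s (x + 1) t = polylogExp s (x * t) := by
  rw [lambertExp, lambertExp, polylogExp, ← (summable_lambertExp s hx ht).tsum_sub
    (summable_lambertExp s (by linarith) ht)]
  refine tsum_congr fun k => ?_
  have h : 1 - Real.exp (-((k + 1 : ℕ) : ℝ) * t) ≠ 0 := by
    have : Real.exp (-((k + 1 : ℕ) : ℝ) * t) < 1 := by
      apply Real.exp_lt_one_iff.mpr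
      have : 0 < ((k + 1 : ℕ) : ℝ) * t := by positivity
      linarith
    linarith
  rw [← mul_sub, ← Complex.ofReal_sub]
  congr 2
  rw [lambertWeight, lambertWeight, ← sub_div, div_eq_iff h, mul_sub, mul_one, ← Real.exp_add]
  congr 2
  ring

/-- With `K = k + 1 ≥ 1`, `K (n + x) ≥ K x + n`, so the double series is dominated by a product of
two convergent single series. -/
theorem summable_double_exp (σ : ℝ) {x t : ℝ} (hx : 0 < x) (ht : 0 < t) :
    Summable fun p : ℕ × ℕ => ((p.1 + 1 : ℕ) : ℝ) ^ σ
      * Real.exp (-(((p.1 + 1 : ℕ) : ℝ) * (p.2 + x)) * t) := by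
  have h1 := summable_rpow_mul_exp σ (mul_pos hx ht)
  have h2 : Summable fun n : ℕ => Real.exp (-(n * t)) := by
    simpa using Real.summable_exp_nat_mul_iff.mpr (neg_lt_zero.mpr ht)
  have h3 := h1.mul_of_nonneg h2 (fun k => by positivity) (fun k => by positivity)
  refine Summable.of_nonneg_of_le (fun k => by positivity) (fun ⟨k, n⟩ => ?_) h3
  dsimp only
  rw [mul_assoc, ← Real.exp_add]
  gcongr
  have h1 : (1 : ℝ) ≤ ((k + 1 : ℕ) : ℝ) := by exact_mod_cast Nat.le_add_left 1 k
  have : 0 ≤ (((k + 1 : ℕ) : ℝ) - 1) * (n * t) := mul_nonneg (by linarith) (by positivity)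
  nlinarith

theorem summable_double_lambert (s : ℂ) {x t : ℝ} (hx : 0 < x) (ht : 0 < t) :
    Summable fun p : ℕ × ℕ => ((p.1 + 1 : ℕ) : ℂ) ^ s
      * (Real.exp (-(((p.1 + 1 : ℕ) : ℝ) * (p.2 + x)) * t) : ℂ) := by
  refine Summable.of_norm ?_
  refine (summable_double_exp s.re hx ht).congr fun p => ?_
  rw [norm_mul, norm_natCast_succ_cpow, Complex.norm_real, Real.norm_of_nonneg (Real.exp_pos _).le]

theorem hasSum_double_lambert (s : ℂ) {x t : ℝ} (hx : 0 < x) (ht : 0 < t) :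
    HasSum (fun p : ℕ × ℕ => ((p.1 + 1 : ℕ) : ℂ) ^ s
      * (Real.exp (-(((p.1 + 1 : ℕ) : ℝ) * (p.2 + x)) * t) : ℂ)) (lambertExp s x t) := by
  have hS := summable_double_lambert s hx ht
  have h := hS.hasSum
  rw [hS.tsum_prod] at h
  convert h using 1
  refine tsum_congr fun k => ?_
  dsimp only
  rw [tsum_mul_left]
  congr 1
  have h1 : Real.exp (-((k + 1 : ℕ) : ℝ) * t) < 1 := by
    apply Real.exp_lt_one_iff.mpr
    have : 0 < ((k + 1 : ℕ) : ℝ) * t := by positivity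
    linarith
  have h2 := (hasSum_geometric_of_lt_one (Real.exp_pos _).le h1).mul_left
    (Real.exp (-((k + 1 : ℕ) : ℝ) * (x * t)))
  rw [← Complex.ofReal_tsum]
  congr 1
  rw [lambertWeight, div_eq_mul_inv, ← h2.tsum_eq]
  refine tsum_congr fun n => ?_
  rw [← Real.exp_nat_mul, ← Real.exp_add]
  congr 1
  ring

/-- The double series summed over `k` first; the asymptotics of the inner sums can then be added up
over `n`. -/
theorem hasSum_polylogExp_shift (s : ℂ) {x t : ℝ} (hx : 0 < x) (ht : 0 < t) :
    HasSum (fun n : ℕ => polylogExp s ((n + x) * t)) (lambertExp s x t) := by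
  have h := (Equiv.prodComm ℕ ℕ).hasSum_iff.mpr (hasSum_double_lambert s hx ht)
  refine h.prod_fiberwise fun n => ?_
  have hn : 0 < (n + x) * t := by positivity
  refine (summable_polylogExp s hn).hasSum.congr_fun fun k => ?_
  simp only [Function.comp_apply, Equiv.prodComm_apply, Prod.swap]
  congr 3
  ring

/-! ### The Gamma integral and Poisson summation -/

theorem integrableOn_rpow_mul_exp_neg {σ r : ℝ} (hσ : -1 < σ) (hr : 0 < r) :
    MeasureTheory.IntegrableOn (fun u : ℝ => u ^ σ * Real.exp (-r * u)) (Set.Ioi 0) := by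
  simpa using integrableOn_rpow_mul_exp_neg_mul_rpow hσ one_pos hr

theorem norm_cpow_mul_cexp_neg (S τ : ℂ) {u : ℝ} (hu : 0 < u) :
    ‖(u : ℂ) ^ S * Complex.exp (-(τ * u))‖ = u ^ S.re * Real.exp (-τ.re * u) := by
  rw [norm_mul, Complex.norm_cpow_eq_rpow_re_of_pos hu, Complex.norm_exp]
  congr 2
  simp

theorem aestronglyMeasurable_cpow_mul_cexp_neg (S τ : ℂ) :
    MeasureTheory.AEStronglyMeasurable (fun u : ℝ => (u : ℂ) ^ S * Complex.exp (-(τ * u)))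
      (MeasureTheory.volume.restrict (Set.Ioi 0)) := by
  refine ContinuousOn.aestronglyMeasurable (fun u hu => ?_) measurableSet_Ioi
  refine ContinuousAt.continuousWithinAt ?_
  refine ContinuousAt.mul ?_ (by fun_prop)
  exact Complex.continuousAt_ofReal_cpow_const _ _ (Or.inr (ne_of_gt hu))

theorem differentiableAt_integral_cpow_mul_cexp_neg {S τ : ℂ} (hS : 0 < S.re) (hτ : 0 < τ.re) :
    DifferentiableAt ℂ
      (fun τ : ℂ => ∫ u in Set.Ioi (0 : ℝ), (u : ℂ) ^ S * Complex.exp (-(τ * u))) τ := by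
  have hS1 : S + 1 ≠ 0 := fun h => by
    have := congrArg Complex.re h
    simp at this
    linarith
  have hs : {z : ℂ | τ.re / 2 < z.re} ∈ 𝓝 τ :=
    (isOpen_lt continuous_const Complex.continuous_re).mem_nhds (half_lt_self hτ)
  refine (hasDerivAt_integral_of_dominated_loc_of_deriv_le
    (μ := MeasureTheory.volume.restrict (Set.Ioi (0 : ℝ)))
    (F := fun (τ : ℂ) (u : ℝ) => (u : ℂ) ^ S * Complex.exp (-(τ * u)))
    (F' := fun (τ : ℂ) (u : ℝ) => -((u : ℂ) ^ (S + 1) * Complex.exp (-(τ * u))))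
    (bound := fun u => u ^ (S.re + 1) * Real.exp (-(τ.re / 2) * u)) hs
    (Eventually.of_forall fun z => aestronglyMeasurable_cpow_mul_cexp_neg S z) ?_
    (aestronglyMeasurable_cpow_mul_cexp_neg (S + 1) τ).neg ?_
    (integrableOn_rpow_mul_exp_neg (by linarith) (half_pos hτ)) ?_).2.differentiableAt
  · refine (integrableOn_rpow_mul_exp_neg (by linarith : -1 < S.re) hτ).mono'
      (aestronglyMeasurable_cpow_mul_cexp_neg S τ) ?_
    filter_upwards [MeasureTheory.ae_restrict_mem measurableSet_Ioi] with u hu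
    exact (norm_cpow_mul_cexp_neg S τ hu).le
  · filter_upwards [MeasureTheory.ae_restrict_mem measurableSet_Ioi] with u hu z hz
    have hu' : 0 < u := hu
    have hz' : τ.re / 2 < z.re := hz
    rw [norm_neg, norm_cpow_mul_cexp_neg _ _ hu, Complex.add_re, Complex.one_re]
    gcongr
  · filter_upwards [MeasureTheory.ae_restrict_mem measurableSet_Ioi] with u hu z hz
    have hu' : (u : ℂ) ≠ 0 := by exact_mod_cast (ne_of_gt hu)
    have h1 : HasDerivAt (fun z : ℂ => Complex.exp (-(z * u))) (Complex.exp (-(z * u)) * -(1 * u)) z :=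
      (((hasDerivAt_id z).mul_const (u : ℂ)).neg).cexp
    refine (h1.const_mul ((u : ℂ) ^ S)).congr_deriv ?_
    rw [Complex.cpow_add _ _ hu', Complex.cpow_one]
    ring

/-- Both sides are holomorphic in `τ` on the right half-plane and agree for real `τ > 0` by Euler's
integral, in particular along `1 + 1 / (n + 1) → 1`; the identity theorem does the rest. Complex `τ`
is needed because the Fourier transform shifts `t` by `2πiξ`. -/
theorem integral_cpow_mul_cexp_neg {S τ : ℂ} (hS : 0 < S.re) (hτ : 0 < τ.re) :
    ∫ u in Set.Ioi (0 : ℝ), (u : ℂ) ^ S * Complex.exp (-(τ * u))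
      = Complex.Gamma (1 + S) * τ ^ (-(1 + S)) := by
  have hU : IsOpen {z : ℂ | 0 < z.re} := isOpen_lt continuous_const Complex.continuous_re
  have h1 : AnalyticOnNhd ℂ
      (fun τ : ℂ => ∫ u in Set.Ioi (0 : ℝ), (u : ℂ) ^ S * Complex.exp (-(τ * u)))
      {z : ℂ | 0 < z.re} :=
    DifferentiableOn.analyticOnNhd (fun z hz =>
      (differentiableAt_integral_cpow_mul_cexp_neg hS hz).differentiableWithinAt) hU
  have h2 : AnalyticOnNhd ℂ (fun τ : ℂ => Complex.Gamma (1 + S) * τ ^ (-(1 + S)))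
      {z : ℂ | 0 < z.re} :=
    DifferentiableOn.analyticOnNhd (fun z hz => DifferentiableAt.differentiableWithinAt
      ((differentiableAt_id.cpow_const (Or.inl hz)).const_mul _)) hU
  refine h1.eqOn_of_preconnected_of_frequently_eq h2
    (convex_halfSpace_re_gt 0).isPreconnected (z₀ := 1) (by simp) ?_ hτ
  have hreal : ∀ r : ℝ, 0 < r → ∫ u in Set.Ioi (0 : ℝ), (u : ℂ) ^ S * Complex.exp (-((r : ℂ) * u))
      = Complex.Gamma (1 + S) * (r : ℂ) ^ (-(1 + S)) := by
    intro r hr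
    have h := Complex.integral_cpow_mul_exp_neg_mul_Ioi (a := 1 + S) (r := r)
      (by simp; linarith) hr
    rw [add_sub_cancel_left] at h
    rw [h, one_div, Complex.inv_cpow _ _ (by
      rw [Complex.arg_ofReal_of_nonneg hr.le]; exact Real.pi_pos.ne), Complex.cpow_neg, mul_comm]
  have ht : Tendsto (fun n : ℕ => ((1 + 1 / ((n : ℝ) + 1) : ℝ) : ℂ)) atTop (𝓝[≠] 1) := by
    refine tendsto_nhdsWithin_iff.mpr ⟨?_, Eventually.of_forall fun n => ?_⟩
    · have := (tendsto_one_div_add_atTop_nhds_zero_nat (𝕜 := ℝ)).const_add 1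
      rw [add_zero] at this
      exact (Complex.continuous_ofReal.tendsto 1).comp this
    · have : (0 : ℝ) < 1 / ((n : ℝ) + 1) := by positivity
      simp only [Set.mem_compl_iff, Set.mem_singleton_iff]
      intro h
      have : (1 + 1 / ((n : ℝ) + 1) : ℝ) = 1 := by exact_mod_cast h
      linarith
  exact ht.frequently (Frequently.of_forall fun n => hreal _ (by positivity))

theorem norm_cpow_neg_le {a z : ℂ} (ha : 4 ≤ a.re) (hz : 1 ≤ ‖z‖) :
    ‖z ^ (-a)‖ ≤ Real.exp (Real.pi * |a.im|) * (‖z‖ ^ 4)⁻¹ := by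
  have hz0 : z ≠ 0 := norm_pos_iff.mp (by linarith)
  rw [Complex.norm_cpow_of_ne_zero hz0, div_eq_mul_inv, ← Real.exp_neg, mul_comm]
  gcongr
  · have := Complex.abs_arg_le_pi z
    calc -(z.arg * (-a).im) ≤ |z.arg * a.im| := by
          rw [Complex.neg_im, mul_neg, neg_neg]; exact le_abs_self _
      _ ≤ Real.pi * |a.im| := by rw [abs_mul]; gcongr
  · rw [← Real.rpow_natCast, ← Real.rpow_neg (norm_nonneg _)]
    refine Real.rpow_le_rpow_of_exponent_le hz ?_
    rw [Complex.neg_re]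
    push_cast
    linarith

open FourierTransform in
/-- Poisson summation for `u ^ S * exp (-t u)`, giving the leading term of `∑ k ^ S exp (-k t)`. -/
theorem polylogExp_poisson_bound {S : ℂ} (hS : 3 ≤ S.re) :
    ∃ C : ℝ, ∀ t : ℝ, 0 < t →
      ‖polylogExp S t - Complex.Gamma (1 + S) * (t : ℂ) ^ (-(1 + S))‖ ≤ C * (1 + t ^ 2)⁻¹ := by
  set A : ℝ := ‖Complex.Gamma (1 + S)‖ * Real.exp (Real.pi * |(1 + S).im|) with hA
  refine ⟨A * ∑' m : ℤ, 1 / (m : ℝ) ^ 2, fun t ht => ?_⟩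
  -- Truncating the base of the power extends the function by `0` to `u ≤ 0` continuously, as `Re S
  -- > 0`. Its integer samples are then exactly the terms of `polylogExp S t`.
  set h : ℝ → ℂ := fun u => ((max u 0 : ℝ) : ℂ) ^ S * Complex.exp (-(t * u)) with hh
  have hcont : Continuous h :=
    ((Complex.continuous_ofReal_cpow_const (by linarith)).comp
      (continuous_id.max continuous_const)).mul (by fun_prop)
  have hS0 : S ≠ 0 := fun h0 => by rw [h0] at hS; norm_num at hS
  have hneg : ∀ u : ℝ, u ≤ 0 → h u = 0 := fun u hu => by
    simp [hh, max_eq_right hu, Complex.zero_cpow hS0]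
  have hpos : ∀ u : ℝ, 0 < u → h u = (u : ℂ) ^ S * Complex.exp (-(t * u)) := fun u hu => by
    simp [hh, max_eq_left hu.le]
  have hfourier : ∀ ξ : ℝ, 𝓕 h ξ
      = Complex.Gamma (1 + S) * (t + 2 * Real.pi * ξ * Complex.I) ^ (-(1 + S)) := by
    intro ξ
    rw [Real.fourier_real_eq_integral_exp_smul, ← integral_cpow_mul_cexp_neg (by linarith)
      (by simp [ht]), ← MeasureTheory.integral_indicator measurableSet_Ioi]
    congr 1
    ext u
    by_cases hu : 0 < u
    · rw [Set.indicator_of_mem (Set.mem_Ioi.mpr hu), hpos u hu, smul_eq_mul, mul_left_comm,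
        ← Complex.exp_add]
      congr 2
      push_cast
      ring
    · rw [Set.indicator_of_notMem (by simpa using hu), hneg u (not_lt.mp hu), smul_zero]
  have hbound : ∀ m : ℝ, 1 ≤ |m| → ‖𝓕 h m‖ ≤ A * (1 + t ^ 2)⁻¹ * (1 / m ^ 2) := by
    intro m hm
    set z : ℂ := t + 2 * Real.pi * m * Complex.I with hz
    have hzsq : ‖z‖ ^ 2 = t ^ 2 + (2 * Real.pi * m) ^ 2 := by
      rw [← Complex.normSq_eq_norm_sq, hz]
      have := Complex.normSq_add_mul_I t (2 * Real.pi * m)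
      push_cast at this
      exact this
    have hm2 : 1 ≤ m ^ 2 := by rw [← sq_abs]; nlinarith
    have hpi := Real.pi_gt_three
    have h4 : m ^ 2 ≤ (2 * Real.pi * m) ^ 2 := by
      rw [mul_pow]
      have : 1 ≤ (2 * Real.pi) ^ 2 := by nlinarith
      nlinarith
    have h1 : 1 + t ^ 2 ≤ ‖z‖ ^ 2 := by rw [hzsq]; linarith
    have h2 : m ^ 2 ≤ ‖z‖ ^ 2 := by rw [hzsq]; nlinarith
    have hz1 : 1 ≤ ‖z‖ := by
      by_contra hlt
      have := norm_nonneg z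
      nlinarith [sq_nonneg t]
    rw [hfourier, norm_mul, hA]
    have h5 := norm_cpow_neg_le (a := 1 + S) (by simp; linarith) hz1
    -- This is where `Re S ≥ 3` is used: of the four powers of `‖z‖`, two give decay in `t` and two
    -- give summability over the frequencies.
    have h6 : (‖z‖ ^ 4)⁻¹ ≤ (1 + t ^ 2)⁻¹ * (1 / m ^ 2) := by
      rw [one_div, ← mul_inv]
      refine inv_anti₀ (by positivity) ?_
      calc (1 + t ^ 2) * m ^ 2 ≤ ‖z‖ ^ 2 * ‖z‖ ^ 2 := by gcongr
        _ = ‖z‖ ^ 4 := by ring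
    calc _ ≤ ‖Complex.Gamma (1 + S)‖ * (Real.exp (Real.pi * |(1 + S).im|)
          * ((1 + t ^ 2)⁻¹ * (1 / m ^ 2))) := by
          refine mul_le_mul_of_nonneg_left (h5.trans ?_) (norm_nonneg _)
          gcongr
      _ = _ := by ring
  have hint : ∀ m : ℤ, m ≠ 0 → ‖𝓕 h (m : ℝ)‖ ≤ A * (1 + t ^ 2)⁻¹ * (1 / (m : ℝ) ^ 2) :=
    fun m hm => hbound m (by exact_mod_cast Int.one_le_abs hm)
  have hsum : Summable fun m : ℤ => A * (1 + t ^ 2)⁻¹ * (1 / (m : ℝ) ^ 2) :=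
    (Real.summable_one_div_int_pow.mpr one_lt_two).mul_left _
  have hdecay : h =O[cocompact ℝ] fun u => |u| ^ (-(2 : ℝ)) := by
    rw [cocompact_eq_atBot_atTop, isBigO_sup]
    constructor
    · refine IsBigO.of_bound 1 ?_
      filter_upwards [eventually_le_atBot 0] with u hu
      rw [hneg u hu, norm_zero]
      positivity
    · have h1 := (isLittleO_exp_neg_mul_rpow_atTop ht (-2 - S.re)).isBigO
      have h2 := (isBigO_refl (fun u : ℝ => u ^ S.re) atTop).mul h1
      refine (IsBigO.of_bound 1 ?_ : h =O[atTop] _).trans (h2.trans (IsBigO.of_bound 1 ?_))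
      · filter_upwards [eventually_gt_atTop 0] with u hu
        rw [hpos u hu, norm_cpow_mul_cexp_neg _ _ hu, one_mul, Complex.ofReal_re]
        exact le_abs_self _
      · filter_upwards [eventually_gt_atTop 0] with u hu
        rw [← Real.rpow_add hu, one_mul, abs_of_pos hu]
        apply le_of_eq
        congr 2
        ring
  have hFsum : Summable fun m : ℤ => 𝓕 h (m : ℝ) := by
    refine Summable.of_norm_bounded_eventually hsum ?_
    have : ({0} : Set ℤ).Finite := Set.finite_singleton 0
    refine this.subset fun m hm => ?_
    by_contra hm0
    exact hm (hint m hm0)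
  have hpoisson := Real.tsum_eq_tsum_fourier_of_rpow_decay_of_summable hcont one_lt_two hdecay
    hFsum 0
  simp only [zero_add, QuotientAddGroup.mk_zero, fourier_eval_zero, mul_one] at hpoisson
  have hleft : ∑' n : ℤ, h n = polylogExp S t := by
    have hinj : Function.Injective fun k : ℕ => ((k + 1 : ℕ) : ℤ) := fun a b hab => by
      simpa using hab
    rw [← hinj.tsum_eq]
    · refine tsum_congr fun k => ?_
      rw [hpos _ (by push_cast; positivity)]
      push_cast
      congr 2
      ring
    · intro n hn
      have hn0 : 0 < n := by
        by_contra hle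
        exact hn (hneg n (by exact_mod_cast not_lt.mp hle))
      exact ⟨(n - 1).toNat, by simp; omega⟩
  -- The zero frequency is the main term; all the others form the error.
  rw [hleft, hFsum.tsum_eq_add_tsum_ite 0] at hpoisson
  rw [hpoisson, hfourier]
  simp only [Int.cast_zero, Complex.ofReal_zero, mul_zero, zero_mul, add_zero, add_sub_cancel_left]
  rw [mul_right_comm, ← tsum_mul_left]
  refine tsum_of_norm_bounded hsum.hasSum fun m => ?_
  split_ifs with hm
  · simp [hm]
  · exact hint m hm

/-! ### Calculus of power-logarithm expansions at `0+` -/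

theorem isBigO_sub_sum_pow_of_le {f : ℝ → ℂ} {c : ℕ → ℂ} {M N : ℕ} (h : M ≤ N)
    (hO : (fun t : ℝ => f t - ∑ i ∈ Finset.range N, c i * (t : ℂ) ^ i) =O[𝓝[>] 0]
      fun t : ℝ => t ^ N) :
    (fun t : ℝ => f t - ∑ i ∈ Finset.range M, c i * (t : ℂ) ^ i) =O[𝓝[>] 0] fun t : ℝ => t ^ M := by
  have hpow : ∀ i, M ≤ i → (fun t : ℝ => t ^ i) =O[𝓝[>] 0] fun t : ℝ => t ^ M := fun i hi => by
    refine IsBigO.of_bound 1 ?_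
    filter_upwards [Ioo_mem_nhdsGT one_pos] with t ht
    rw [one_mul, norm_pow, norm_pow, Real.norm_of_nonneg ht.1.le]
    exact pow_le_pow_of_le_one ht.1.le ht.2.le hi
  have h1 : (fun t : ℝ => ∑ i ∈ Finset.Ico M N, c i * (t : ℂ) ^ i) =O[𝓝[>] 0]
      fun t : ℝ => t ^ M := by
    refine IsBigO.fun_sum fun i hi => IsBigO.const_mul_left ?_ _
    refine IsBigO.trans (IsBigO.of_bound 1 (Eventually.of_forall fun t => ?_))
      (hpow i (Finset.mem_Ico.mp hi).1)
    simp
  refine ((hO.trans (hpow N h)).add h1).congr_left fun t => ?_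
  rw [← Finset.sum_range_add_sum_Ico _ h]
  ring

/-- `f` has an expansion `(α + β log t) t ^ σ + ∑_{i < N} c i t ^ i + O(t ^ N)` as `t → 0+`, where
a logarithm only occurs if `σ` is a natural number. -/
def PowLogExpansion (σ : ℂ) (N : ℕ) (f : ℝ → ℂ) : Prop :=
  ∃ (α β : ℂ) (c : ℕ → ℂ), (β = 0 ∨ ∃ n : ℕ, σ = n) ∧
    (fun t : ℝ => f t - ((α + β * (Real.log t : ℂ)) * (t : ℂ) ^ σ
      + ∑ i ∈ Finset.range N, c i * (t : ℂ) ^ i)) =O[𝓝[>] 0] fun t : ℝ => t ^ N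

namespace PowLogExpansion

variable {σ : ℂ} {N : ℕ} {f g : ℝ → ℂ}

theorem congr (hf : PowLogExpansion σ N f) (h : ∀ᶠ t in 𝓝[>] (0 : ℝ), g t = f t) :
    PowLogExpansion σ N g := by
  obtain ⟨α, β, c, hβ, hO⟩ := hf
  refine ⟨α, β, c, hβ, hO.congr' ?_ EventuallyEq.rfl⟩
  filter_upwards [h] with t ht
  rw [ht]

theorem of_isBigO (σ : ℂ) (hf : f =O[𝓝[>] 0] fun t : ℝ => t ^ N) : PowLogExpansion σ N f :=
  ⟨0, 0, 0, Or.inl rfl, by simpa using hf⟩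

theorem cpow (α σ : ℂ) (N : ℕ) : PowLogExpansion σ N fun t : ℝ => α * (t : ℂ) ^ σ :=
  ⟨α, 0, 0, Or.inl rfl, by simpa using isBigO_zero _ _⟩

theorem add (hf : PowLogExpansion σ N f) (hg : PowLogExpansion σ N g) :
    PowLogExpansion σ N fun t => f t + g t := by
  obtain ⟨α, β, c, hβ, hO⟩ := hf
  obtain ⟨α', β', c', hβ', hO'⟩ := hg
  refine ⟨α + α', β + β', fun i => c i + c' i, ?_, (hO.add hO').congr_left fun t => ?_⟩
  · rcases hβ with rfl | h
    · rcases hβ' with rfl | h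
      · left; simp
      · right; exact h
    · right; exact h
  · simp only [add_mul, Finset.sum_add_distrib]
    ring

theorem const_mul (a : ℂ) (hf : PowLogExpansion σ N f) :
    PowLogExpansion σ N fun t => a * f t := by
  obtain ⟨α, β, c, hβ, hO⟩ := hf
  refine ⟨a * α, a * β, fun i => a * c i, ?_, (hO.const_mul_left a).congr_left fun t => ?_⟩
  · rcases hβ with rfl | h
    · left; simp
    · right; exact h
  · simp only [mul_assoc, ← Finset.mul_sum]
    ring

theorem sum {ι : Type*} (s : Finset ι) {F : ι → ℝ → ℂ} (h : ∀ i ∈ s, PowLogExpansion σ N (F i)) :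
    PowLogExpansion σ N fun t => ∑ i ∈ s, F i t := by
  classical
  induction s using Finset.induction_on with
  | empty => simpa using of_isBigO σ (isBigO_zero (E' := ℂ) (fun t : ℝ => t ^ N) (𝓝[>] 0))
  | insert a s ha ih =>
    simp only [Finset.sum_insert ha]
    exact (h a (Finset.mem_insert_self a s)).add
      (ih fun i hi => h i (Finset.mem_insert_of_mem hi))

theorem mono {M : ℕ} (hf : PowLogExpansion σ N f) (h : M ≤ N) : PowLogExpansion σ M f := by
  obtain ⟨α, β, c, hβ, hO⟩ := hf
  refine ⟨α, β, c, hβ, ?_⟩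
  simp only [← sub_sub] at hO ⊢
  exact isBigO_sub_sum_pow_of_le h hO

theorem comp_mul_left {x : ℝ} (hx : 0 < x) (hf : PowLogExpansion σ N f) :
    PowLogExpansion σ N fun t => f (x * t) := by
  obtain ⟨α, β, c, hβ, hO⟩ := hf
  refine ⟨(α + β * (Real.log x : ℂ)) * (x : ℂ) ^ σ, β * (x : ℂ) ^ σ, fun i => c i * (x : ℂ) ^ i,
    ?_, ?_⟩
  · rcases hβ with rfl | h
    · left; simp
    · right; exact h
  · have ht : Tendsto (fun t : ℝ => x * t) (𝓝[>] 0) (𝓝[>] 0) := by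
      refine tendsto_nhdsWithin_iff.mpr ⟨?_, ?_⟩
      · have : Tendsto (fun t : ℝ => x * t) (𝓝 0) (𝓝 (x * 0)) := by
          exact (continuous_const_mul x).tendsto 0
        rw [mul_zero] at this
        exact this.mono_left nhdsWithin_le_nhds
      · filter_upwards [self_mem_nhdsWithin] with t ht
        exact mul_pos hx ht
    have h1 := hO.comp_tendsto ht
    have h2 : ((fun t : ℝ => t ^ N) ∘ fun t => x * t) =O[𝓝[>] 0] fun t : ℝ => t ^ N := by
      refine IsBigO.of_bound (x ^ N) (Eventually.of_forall fun t => ?_)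
      simp only [Function.comp_apply, mul_pow, norm_mul, norm_pow, Real.norm_of_nonneg hx.le]
      exact le_rfl
    refine (h1.trans h2).congr' ?_ EventuallyEq.rfl
    filter_upwards [self_mem_nhdsWithin] with t ht
    have ht' : 0 < t := ht
    simp only [Function.comp_apply]
    rw [Real.log_mul hx.ne' ht'.ne', Complex.ofReal_mul, Complex.mul_cpow_ofReal_nonneg hx.le ht'.le]
    simp only [mul_pow, mul_assoc]
    push_cast
    ring

theorem id_mul (hf : PowLogExpansion σ N f) :
    PowLogExpansion (σ + 1) (N + 1) fun t => t * f t := by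
  obtain ⟨α, β, c, hβ, hO⟩ := hf
  refine ⟨α, β, fun | 0 => 0 | i + 1 => c i, ?_, ?_⟩
  · rcases hβ with h | ⟨n, rfl⟩
    · left; exact h
    · right; exact ⟨n + 1, by push_cast; rfl⟩
  · have h1 : (fun t : ℝ => (t : ℂ)) =O[𝓝[>] 0] fun t : ℝ => t :=
      IsBigO.of_bound 1 (Eventually.of_forall fun t => by simp)
    refine (h1.mul hO).congr' ?_ (Eventually.of_forall fun t => (pow_succ' t N).symm)
    filter_upwards [self_mem_nhdsWithin] with t ht
    have ht' : (t : ℂ) ≠ 0 := by exact_mod_cast (ne_of_gt ht)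
    rw [Finset.sum_range_succ', Complex.cpow_add _ _ ht', Complex.cpow_one]
    simp only [pow_succ, ← mul_assoc, ← Finset.sum_mul]
    ring

theorem id_pow_mul (hf : PowLogExpansion σ N f) (k : ℕ) :
    PowLogExpansion (σ + k) (N + k) fun t => t ^ k * f t := by
  induction k with
  | zero => simpa using hf
  | succ k ih =>
    have h := ih.id_mul
    rw [show σ + (k : ℂ) + 1 = σ + ((k + 1 : ℕ) : ℂ) by push_cast; ring] at h
    exact h.congr (Eventually.of_forall fun t => by ring)

end PowLogExpansion

/-- The mean value inequality bounds `G t - G u` by a multiple of `t ^ (N + 1)` for `u ≤ t`, so `G`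
is Cauchy at `0+`; letting `u → 0` gives the rate. The limit is the constant of integration in
`PowLogExpansion.of_hasDerivAt`. -/
theorem exists_limit_of_hasDerivAt_isBigO {G G' : ℝ → ℂ} {N : ℕ}
    (hG : ∀ t, 0 < t → HasDerivAt G (G' t) t) (hO : G' =O[𝓝[>] 0] fun t : ℝ => t ^ N) :
    ∃ l : ℂ, (fun t => G t - l) =O[𝓝[>] 0] fun t : ℝ => t ^ (N + 1) := by
  obtain ⟨C, hC⟩ := hO.bound
  obtain ⟨δ, hδ, hδC⟩ := mem_nhdsGT_iff_exists_Ioo_subset.mp hC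
  have hδ : 0 < δ := hδ
  have hbound : ∀ u t : ℝ, 0 < u → u ≤ t → t < δ → ‖G t - G u‖ ≤ |C| * t ^ (N + 1) := by
    intro u t hu hut ht
    have h1 := Convex.norm_image_sub_le_of_norm_hasDerivWithin_le (C := |C| * t ^ N)
      (fun v hv => (hG v (hu.trans_le hv.1)).hasDerivWithinAt) (fun v hv => ?_)
      (convex_Icc u t) (Set.left_mem_Icc.mpr hut) (Set.right_mem_Icc.mpr hut)
    · refine h1.trans ?_
      rw [Real.norm_of_nonneg (by linarith), pow_succ, ← mul_assoc]
      have : 0 < t := by linarith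
      gcongr
      linarith
    · have hv0 : 0 < v := hu.trans_le hv.1
      have h2 : ‖G' v‖ ≤ C * ‖v ^ N‖ := hδC ⟨hv0, hv.2.trans_lt ht⟩
      rw [norm_pow, Real.norm_of_nonneg hv0.le] at h2
      refine h2.trans ?_
      have := hv.2
      gcongr
      exact le_abs_self C
  have hcauchy : Cauchy (map G (𝓝[>] 0)) := by
    rw [Metric.cauchy_iff]
    refine ⟨inferInstance, fun ε hε => ?_⟩
    have h0 : Tendsto (fun t : ℝ => |C| * t ^ (N + 1)) (𝓝[>] 0) (𝓝 0) := by
      have : Tendsto (fun t : ℝ => |C| * t ^ (N + 1)) (𝓝 0) (𝓝 (|C| * 0 ^ (N + 1))) :=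
        Continuous.tendsto (by fun_prop) 0
      rw [zero_pow N.succ_ne_zero, mul_zero] at this
      exact this.mono_left nhdsWithin_le_nhds
    have h1 : {t : ℝ | |C| * t ^ (N + 1) < ε} ∩ Set.Ioo 0 δ ∈ 𝓝[>] (0 : ℝ) :=
      inter_mem (h0.eventually_lt_const hε) (Ioo_mem_nhdsGT hδ)
    refine ⟨_, image_mem_map h1, ?_⟩
    rintro _ ⟨u, hu, rfl⟩ _ ⟨t, ht, rfl⟩
    rcases le_total u t with h | h
    · rw [dist_comm, dist_eq_norm]
      exact (hbound u t hu.2.1 h ht.2.2).trans_lt ht.1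
    · rw [dist_eq_norm]
      exact (hbound t u ht.2.1 h hu.2.2).trans_lt hu.1
  obtain ⟨l, hl⟩ := cauchy_map_iff_exists_tendsto.mp hcauchy
  refine ⟨l, IsBigO.of_bound |C| ?_⟩
  filter_upwards [Ioo_mem_nhdsGT hδ] with t ht
  rw [norm_pow, Real.norm_of_nonneg ht.1.le]
  refine le_of_tendsto (hl.const_sub (G t)).norm ?_
  filter_upwards [Ioo_mem_nhdsGT ht.1] with u hu
  exact hbound u t hu.1 hu.2.le ht.2

theorem PowLogExpansion.of_hasDerivAt {σ : ℂ} {N : ℕ} {f f' : ℝ → ℂ}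
    (hf : ∀ t, 0 < t → HasDerivAt f (f' t) t) (h : PowLogExpansion σ N f') :
    PowLogExpansion (σ + 1) (N + 1) f := by
  obtain ⟨α, β, c, hβ, hO⟩ := h
  obtain ⟨α', β', hβ', hA⟩ : ∃ α' β' : ℂ, (β' = 0 ∨ ∃ n : ℕ, σ + 1 = n) ∧ ∀ t : ℝ, 0 < t →
      HasDerivAt (fun t : ℝ => (α' + β' * (Real.log t : ℂ)) * (t : ℂ) ^ (σ + 1))
        ((α + β * (Real.log t : ℂ)) * (t : ℂ) ^ σ) t := by
    have hlog : ∀ t : ℝ, 0 < t → HasDerivAt (fun t : ℝ => (Real.log t : ℂ)) ((t⁻¹ : ℝ) : ℂ) t :=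
      fun t ht => (Real.hasDerivAt_log ht.ne').ofReal_comp
    by_cases hσ : σ + 1 = 0
    · have hσ' : σ = -1 := by linear_combination hσ
      -- A term `t⁻¹ log t` would integrate to a squared logarithm. It cannot occur, because
      -- logarithms are allowed only at natural exponents and `-1` is not one.
      have hβ0 : β = 0 := by
        rcases hβ with h | ⟨n, hn⟩
        · exact h
        · exfalso
          rw [hn] at hσ
          exact Nat.cast_add_one_ne_zero n hσ
      refine ⟨0, α, Or.inr ⟨0, by simp [hσ]⟩, fun t ht => ?_⟩
      have h1 := (hlog t ht).const_mul α
      simp only [hσ, Complex.cpow_zero, mul_one, zero_add]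
      refine h1.congr_deriv ?_
      rw [hβ0, hσ', Complex.cpow_neg_one]
      push_cast
      ring
    -- The coefficients come from the primitive of `t ^ σ log t`, obtained by parts.
    · refine ⟨α / (σ + 1) - β / (σ + 1) ^ 2, β / (σ + 1), ?_, fun t ht => ?_⟩
      · rcases hβ with rfl | ⟨n, rfl⟩
        · left; simp
        · right; exact ⟨n + 1, by push_cast; rfl⟩
      · have ht' : (t : ℂ) ≠ 0 := by exact_mod_cast ht.ne'
        have h1 : HasDerivAt (fun t : ℝ => (t : ℂ) ^ (σ + 1)) ((σ + 1) * (t : ℂ) ^ σ) t := by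
          have := (hasDerivAt_id (t : ℂ)).cpow_const (c := σ + 1) (Or.inl (by simpa using ht))
          simpa using this.comp_ofReal
        refine ((((hlog t ht).const_mul (β / (σ + 1))).const_add _).mul h1).congr_deriv ?_
        rw [Complex.cpow_add _ _ ht', Complex.cpow_one]
        push_cast
        field_simp
        ring
  have hS : ∀ t : ℝ, HasDerivAt (fun t : ℝ => ∑ i ∈ Finset.range N, c i / (i + 1) * (t : ℂ) ^ (i + 1))
      (∑ i ∈ Finset.range N, c i * (t : ℂ) ^ i) t := by
    intro t
    refine HasDerivAt.fun_sum fun i _ => ?_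
    have h1 : HasDerivAt (fun t : ℝ => (t : ℂ) ^ (i + 1)) (((i + 1 : ℕ) : ℂ) * (t : ℂ) ^ i) t := by
      simpa using (hasDerivAt_pow (i + 1) (t : ℂ)).comp_ofReal
    refine (h1.const_mul _).congr_deriv ?_
    have : (i : ℂ) + 1 ≠ 0 := Nat.cast_add_one_ne_zero i
    push_cast
    field_simp
  obtain ⟨l, hl⟩ := exists_limit_of_hasDerivAt_isBigO
    (fun t ht => (hf t ht).sub ((hA t ht).add (hS t))) hO
  refine ⟨α', β', fun | 0 => l | i + 1 => c i / (i + 1), hβ', hl.congr_left fun t => ?_⟩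
  rw [Finset.sum_range_succ']
  simp only [Pi.sub_apply, Pi.add_apply, pow_zero, mul_one]
  ring

/-! ### Expansion of the sums `∑ k ^ s exp (-k t)` -/

/-- For `Re s ≥ 3` Poisson summation gives order `0`. Since the derivative of `polylogExp s` is
`-polylogExp (s + 1)`, each integration lowers `s` by one and gains one order; starting far enough
to the right reaches every `s` and `N`. -/
theorem powLogExpansion_polylogExp (s : ℂ) (N : ℕ) :
    PowLogExpansion (-(1 + s)) N (polylogExp s) := by
  have h0 : ∀ S : ℂ, 3 ≤ S.re → PowLogExpansion (-(1 + S)) 0 (polylogExp S) := by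
    intro S hS
    obtain ⟨C, hC⟩ := polylogExp_poisson_bound hS
    have h1 := (PowLogExpansion.cpow (Complex.Gamma (1 + S)) (-(1 + S)) 0).add
      (PowLogExpansion.of_isBigO (-(1 + S)) (N := 0)
        (f := fun t => polylogExp S t - Complex.Gamma (1 + S) * (t : ℂ) ^ (-(1 + S))) ?_)
    · exact h1.congr (Eventually.of_forall fun t => by ring)
    · refine IsBigO.of_bound |C| ?_
      filter_upwards [self_mem_nhdsWithin] with t ht
      refine (hC t ht).trans ?_
      have : (1 + t ^ 2)⁻¹ ≤ 1 := inv_le_one_of_one_le₀ (by nlinarith [sq_nonneg t])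
      simp only [pow_zero, norm_one]
      gcongr
      exact le_abs_self C
  have hJ : ∀ J : ℕ, ∀ s : ℂ, 3 ≤ s.re + J → PowLogExpansion (-(1 + s)) J (polylogExp s) := by
    intro J
    induction J with
    | zero => intro s hs; exact h0 s (by simpa using hs)
    | succ J ih =>
      intro s hs
      have h1 := (ih (s + 1) (by push_cast at hs; simp; linarith)).const_mul (-1)
      have h2 := PowLogExpansion.of_hasDerivAt (f := polylogExp s)
        (fun t ht => by simpa using hasDerivAt_polylogExp s ht) h1
      convert h2 using 1
      ring
  obtain ⟨J, hJ'⟩ := exists_nat_ge (3 - s.re)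
  exact (hJ (max J N) s (by
    have : (J : ℝ) ≤ ((max J N : ℕ) : ℝ) := by exact_mod_cast le_max_left J N
    linarith)).mono (le_max_right J N)

/-! ### Leading term of the Lambert series for large exponents -/

/-- A telescoping substitute for comparison with `∫ du / (1 + u ^ 2)`: with `u = (M + 1) t`, `(1 + M
t) (1 + u) ≤ (1 + u) ^ 2 ≤ 2 (1 + u ^ 2)`. -/
theorem sum_range_inv_one_add_sq_le {t : ℝ} (ht : 0 < t) (M : ℕ) :
    ∑ n ∈ Finset.range (M + 1), (1 + ((n : ℝ) * t) ^ 2)⁻¹ ≤ 2 + 2 / t * (1 - (1 + M * t)⁻¹) := by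
  induction M with
  | zero => simp
  | succ M ih =>
    rw [Finset.sum_range_succ]
    have h1 : (0 : ℝ) < 1 + M * t := by positivity
    have h2 : (0 : ℝ) < 1 + ((M + 1 : ℕ) : ℝ) * t := by positivity
    have h3 : (1 + (((M + 1 : ℕ) : ℝ) * t) ^ 2)⁻¹
        ≤ 2 / t * ((1 + M * t)⁻¹ - (1 + ((M + 1 : ℕ) : ℝ) * t)⁻¹) := by
      have h4 : 2 / t * ((1 + M * t)⁻¹ - (1 + ((M + 1 : ℕ) : ℝ) * t)⁻¹)
          = ((1 + M * t) * (1 + ((M + 1 : ℕ) : ℝ) * t) / 2)⁻¹ := by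
        field_simp
        push_cast
        ring
      rw [h4]
      refine inv_anti₀ (by positivity) ?_
      push_cast
      nlinarith [sq_nonneg (1 - ((M : ℝ) + 1) * t), mul_pos ht h2]
    calc _ ≤ _ := add_le_add ih h3
      _ = _ := by ring

theorem tsum_inv_one_add_sq_le {v t : ℝ} (hv : 0 < v) (ht : 0 < t) (ht1 : t ≤ 1) :
    Summable (fun n : ℕ => (1 + ((n + v) * t) ^ 2)⁻¹) ∧
      ∑' n : ℕ, (1 + ((n + v) * t) ^ 2)⁻¹ ≤ 4 / t := by
  have h : ∀ M : ℕ, ∑ n ∈ Finset.range M, (1 + ((n + v) * t) ^ 2)⁻¹ ≤ 4 / t := by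
    intro M
    calc ∑ n ∈ Finset.range M, (1 + ((n + v) * t) ^ 2)⁻¹
        ≤ ∑ n ∈ Finset.range (M + 1), (1 + ((n : ℝ) * t) ^ 2)⁻¹ := by
          rw [Finset.sum_range_succ]
          refine (Finset.sum_le_sum fun n _ => ?_).trans (le_add_of_nonneg_right (by positivity))
          gcongr
          linarith
      _ ≤ 2 + 2 / t * (1 - (1 + M * t)⁻¹) := sum_range_inv_one_add_sq_le ht M
      _ ≤ 2 + 2 / t * 1 := by
          gcongr
          have : 0 ≤ (1 + M * t)⁻¹ := by positivity
          linarith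
      _ ≤ 2 / t + 2 / t := by
          have : 2 ≤ 2 / t := by rw [le_div_iff₀ ht]; linarith
          linarith
      _ = 4 / t := by ring
  exact ⟨summable_of_sum_range_le (fun n => by positivity) h,
    Real.tsum_le_of_sum_range_le (fun n => by positivity) h⟩

/-- The Poisson main terms at `(n + v) t` add up to a Hurwitz zeta value, and the errors `(1 + ((n +
v) t) ^ 2)⁻¹` to `O(1 / t)`. Uniformity in `v` matters because the estimate is integrated over `v =
x + w`. -/
theorem lambertExp_leading {S : ℂ} (hS : 3 ≤ S.re) :
    ∃ C : ℝ, 0 ≤ C ∧ ∀ v t : ℝ, 0 < v → 0 < t → t ≤ 1 →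
      ‖lambertExp S v t - Complex.Gamma (1 + S) * (t : ℂ) ^ (-(1 + S)) * hurwitzZetaPos v (1 + S)‖
        ≤ C / t := by
  obtain ⟨C, hC⟩ := polylogExp_poisson_bound hS
  refine ⟨|C| * 4, by positivity, fun v t hv ht ht1 => ?_⟩
  have h1 := hasSum_polylogExp_shift S hv ht
  have h2 := (hasSum_hurwitzZetaPos hv (s := 1 + S) (by simp; linarith)).mul_left
    (Complex.Gamma (1 + S) * (t : ℂ) ^ (-(1 + S)))
  have h3 := h1.sub h2
  rw [← h3.tsum_eq]
  obtain ⟨hs, hle⟩ := tsum_inv_one_add_sq_le hv ht ht1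
  refine (tsum_of_norm_bounded (hs.mul_left |C|).hasSum fun n => ?_).trans ?_
  · have hn : 0 < (n : ℝ) + v := by positivity
    have h4 : Complex.Gamma (1 + S) * (t : ℂ) ^ (-(1 + S)) * (1 / (((n : ℝ) + v : ℝ) : ℂ) ^ (1 + S))
        = Complex.Gamma (1 + S) * ((((n : ℝ) + v) * t : ℝ) : ℂ) ^ (-(1 + S)) := by
      rw [Complex.ofReal_mul, Complex.mul_cpow_ofReal_nonneg hn.le ht.le,
        Complex.cpow_neg (((n : ℝ) + v : ℝ) : ℂ)]
      ring
    rw [h4]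
    refine (hC _ (by positivity)).trans ?_
    gcongr
    exact le_abs_self C
  · rw [tsum_mul_left, mul_div_assoc]
    gcongr

theorem continuousOn_hurwitzZetaPos {s : ℂ} (hs : 1 < s.re) :
    ContinuousOn (fun v => hurwitzZetaPos v s) (Set.Ioi 0) := by
  intro v hv
  have hv' : 0 < v := hv
  refine ContinuousAt.continuousWithinAt ?_
  have key : ContinuousOn (fun v => ∑' n : ℕ, 1 / (((n : ℝ) + v : ℝ) : ℂ) ^ s)
      (Set.Ioi (v / 2)) := by
    refine continuousOn_tsum (fun n => ?_)
      (hasSum_hurwitzZetaPos (half_pos hv') hs).summable.norm (fun n y hy => ?_)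
    · intro y hy
      have hy' : v / 2 < y := hy
      have hn : 0 < (n : ℝ) + y := by have := n.cast_nonneg (α := ℝ); linarith
      refine ContinuousAt.continuousWithinAt (ContinuousAt.div continuousAt_const ?_ ?_)
      · exact (Complex.continuousAt_ofReal_cpow_const _ s (Or.inr hn.ne')).comp
          (f := fun y : ℝ => (n : ℝ) + y) (by fun_prop)
      · rw [Complex.cpow_ne_zero_iff]
        left
        exact_mod_cast hn.ne'
    · have hy' : v / 2 < y := hy
      have hn1 : 0 < (n : ℝ) + v / 2 := by positivity
      have hn : 0 < (n : ℝ) + y := by linarith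
      rw [norm_div, norm_div, Complex.norm_cpow_eq_rpow_re_of_pos hn,
        Complex.norm_cpow_eq_rpow_re_of_pos hn1]
      gcongr
  refine (key.continuousAt (Ioi_mem_nhds (half_lt_self hv'))).congr ?_
  filter_upwards [Ioi_mem_nhds hv'] with y hy
  exact (hasSum_hurwitzZetaPos hy hs).tsum_eq

/-! ### Integration by parts in the parameter `x` -/

section ByParts

variable {x t : ℝ}

theorem hasDerivAt_lambertExp_shift (s : ℂ) (hx : 0 < x) (ht : 0 < t) {w : ℝ} (hw : 0 ≤ w) :
    HasDerivAt (fun w => lambertExp s (x + w) t) (-(t * lambertExp (s + 1) (x + w) t)) w :=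
  HasDerivAt.comp_const_add x w (hasDerivAt_lambertExp s (by linarith) ht)

theorem continuousOn_lambertExp_shift (s : ℂ) (hx : 0 < x) (ht : 0 < t) :
    ContinuousOn (fun w => lambertExp s (x + w) t) (Set.uIcc 0 1) := fun w hw => by
  rw [Set.uIcc_of_le zero_le_one] at hw
  exact (hasDerivAt_lambertExp_shift s hx ht hw.1).continuousAt.continuousWithinAt

theorem intervalIntegrable_mul_lambertExp {P : ℝ → ℂ} (hP : Continuous P) (s : ℂ) (hx : 0 < x)
    (ht : 0 < t) : IntervalIntegrable (fun w => P w * lambertExp s (x + w) t)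
      MeasureTheory.volume 0 1 :=
  ContinuousOn.intervalIntegrable (hP.continuousOn.mul (continuousOn_lambertExp_shift s hx ht))

theorem integral_mul_lambertExp {Q Q' : ℝ → ℂ} (hQ : ∀ w, HasDerivAt Q (Q' w) w)
    (hQ' : Continuous Q') (s : ℂ) (hx : 0 < x) (ht : 0 < t) :
    ∫ w in (0 : ℝ)..1, Q' w * lambertExp s (x + w) t
      = Q 1 * lambertExp s (x + 1) t - Q 0 * lambertExp s x t
        + t * ∫ w in (0 : ℝ)..1, Q w * lambertExp (s + 1) (x + w) t := by
  have h := intervalIntegral.integral_deriv_mul_eq_sub_of_hasDeriv_right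
    (a := 0) (b := 1) (u := Q) (v := fun w => lambertExp s (x + w) t) (u' := Q')
    (v' := fun w => -(t * lambertExp (s + 1) (x + w) t))
    (fun w _ => (hQ w).continuousAt.continuousWithinAt) (continuousOn_lambertExp_shift s hx ht)
    (fun w _ => (hQ w).hasDerivWithinAt)
    (fun w hw => (hasDerivAt_lambertExp_shift s hx ht (by
      rw [min_eq_left zero_le_one] at hw; exact hw.1.le)).hasDerivWithinAt)
    (hQ'.intervalIntegrable _ _)
    (ContinuousOn.intervalIntegrable
      (((continuousOn_lambertExp_shift (s + 1) hx ht).const_smul (t : ℂ)).neg))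
  have hQc : Continuous Q := continuous_iff_continuousAt.mpr fun w => (hQ w).continuousAt
  have hI2 : IntervalIntegrable (fun w => Q w * -(t * lambertExp (s + 1) (x + w) t))
      MeasureTheory.volume 0 1 := by
    refine ((intervalIntegrable_mul_lambertExp hQc (s + 1) hx ht).const_mul (-(t : ℂ))).congr
      (fun w _ => ?_)
    ring
  rw [intervalIntegral.integral_add (intervalIntegrable_mul_lambertExp hQ' s hx ht) hI2] at h
  have h2 : ∫ w in (0 : ℝ)..1, Q w * -(t * lambertExp (s + 1) (x + w) t)
      = -(t * ∫ w in (0 : ℝ)..1, Q w * lambertExp (s + 1) (x + w) t) := by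
    rw [← intervalIntegral.integral_const_mul, ← intervalIntegral.integral_neg]
    congr 1
    ext w
    ring
  rw [h2, add_zero] at h
  linear_combination h

/-- The derivative in `x` raises `s` by one, so this integral telescopes to a unit difference, which
is a sum without the denominators `1 - exp (-k t)`. -/
theorem integral_lambertExp (s : ℂ) (hx : 0 < x) (ht : 0 < t) :
    t * ∫ w in (0 : ℝ)..1, lambertExp s (x + w) t = polylogExp (s - 1) (x * t) := by
  have h := intervalIntegral.integral_eq_sub_of_hasDerivAt (a := 0) (b := 1)
    (f := fun w => lambertExp (s - 1) (x + w) t)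
    (f' := fun w => -(t * lambertExp (s - 1 + 1) (x + w) t))
    (fun w hw => hasDerivAt_lambertExp_shift (s - 1) hx ht (by
      rw [Set.uIcc_of_le zero_le_one] at hw; exact hw.1))
    (ContinuousOn.intervalIntegrable
      (((continuousOn_lambertExp_shift (s - 1 + 1) hx ht).const_smul (t : ℂ)).neg))
  rw [intervalIntegral.integral_neg, intervalIntegral.integral_const_mul, sub_add_cancel,
    add_zero] at h
  rw [← lambertExp_sub_lambertExp_add_one (s - 1) hx ht]
  linear_combination -h

end ByParts

/-- An Euler–Maclaurin formula. Each step gains a factor `t` and raises the exponent in the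
remainder by one, until `lambertExp_leading` applies. The constants `b` and the kernel `P` depend on
neither `x` nor `t`. -/
theorem exists_lambertExp_byParts (s : ℂ) (J : ℕ) :
    ∃ (b : ℕ → ℂ) (P : ℝ → ℂ), Continuous P ∧ ∀ x t : ℝ, 0 < x → 0 < t →
      t * lambertExp s x t
        = ∑ k ∈ Finset.range (J + 1), b k * ((t : ℂ) ^ k * polylogExp (s - 1 + k) (x * t))
          + (t : ℂ) ^ (J + 2) * ∫ w in (0 : ℝ)..1, P w * lambertExp (s + J + 1) (x + w) t := by
  induction J with
  | zero =>
    refine ⟨fun _ => 1, fun w => 1 - w, by fun_prop, fun x t hx ht => ?_⟩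
    have hQ : ∀ w : ℝ, HasDerivAt (fun w : ℝ => (w : ℂ) - 1) 1 w := fun w =>
      Complex.ofRealCLM.hasDerivAt.sub_const 1
    have h1 := integral_mul_lambertExp hQ continuous_const s hx ht
    have h2 := integral_lambertExp s hx ht
    have h3 : ∫ w in (0 : ℝ)..1, (1 - (w : ℂ)) * lambertExp (s + 1) (x + w) t
        = -∫ w in (0 : ℝ)..1, ((w : ℂ) - 1) * lambertExp (s + 1) (x + w) t := by
      rw [← intervalIntegral.integral_neg]
      congr 1
      ext w
      ring
    simp only [one_mul, Complex.ofReal_one, Complex.ofReal_zero, sub_self, zero_mul, zero_sub,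
      neg_mul] at h1
    simp only [zero_add, Finset.sum_range_one, pow_zero, Nat.cast_zero, add_zero, one_mul, h3, ← h2,
      h1]
    ring
  | succ J ih =>
    obtain ⟨b, P, hP, h⟩ := ih
    -- The mean of the kernel contributes the next `polylogExp` term. The mean-free part has a
    -- primitive vanishing at `0` and `1`, so integrating by parts leaves no boundary terms.
    set m : ℂ := ∫ w in (0 : ℝ)..1, P w with hm
    set Q : ℝ → ℂ := fun w => ∫ y in (0 : ℝ)..w, (P y - m) with hQdef
    have hQ : ∀ w, HasDerivAt Q (P w - m) w := fun w =>
      ((hP.sub continuous_const).integral_hasStrictDerivAt 0 w).hasDerivAt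
    have hQc : Continuous Q := continuous_iff_continuousAt.mpr fun w => (hQ w).continuousAt
    have hQ0 : Q 0 = 0 := intervalIntegral.integral_same
    have hQ1 : Q 1 = 0 := by
      rw [hQdef]
      simp only
      rw [intervalIntegral.integral_sub (hP.intervalIntegrable _ _)
        (continuous_const.intervalIntegrable _ _)]
      simp [hm]
    refine ⟨Function.update b (J + 1) m, Q, hQc, fun x t hx ht => ?_⟩
    have h1 := integral_mul_lambertExp hQ (hP.sub continuous_const) (s + J + 1) hx ht
    have h2 := integral_lambertExp (s + J + 1) hx ht
    have h3 : ∫ w in (0 : ℝ)..1, (P w - m) * lambertExp (s + J + 1) (x + w) t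
        = (∫ w in (0 : ℝ)..1, P w * lambertExp (s + J + 1) (x + w) t)
          - m * ∫ w in (0 : ℝ)..1, lambertExp (s + J + 1) (x + w) t := by
      rw [← intervalIntegral.integral_const_mul, ← intervalIntegral.integral_sub
        (intervalIntegrable_mul_lambertExp hP _ hx ht)
        (intervalIntegrable_mul_lambertExp continuous_const _ hx ht)]
      congr 1
      ext w
      ring
    rw [h3, hQ0, hQ1, zero_mul, zero_mul, sub_zero, zero_add, sub_eq_iff_eq_add] at h1
    rw [h x t hx ht, h1, Finset.sum_range_succ _ (J + 1), Function.update_self]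
    have h4 : ∑ k ∈ Finset.range (J + 1), Function.update b (J + 1) m k
          * ((t : ℂ) ^ k * polylogExp (s - 1 + k) (x * t))
        = ∑ k ∈ Finset.range (J + 1), b k * ((t : ℂ) ^ k * polylogExp (s - 1 + k) (x * t)) :=
      Finset.sum_congr rfl fun k hk => by
        rw [Function.update_of_ne (by have := Finset.mem_range.mp hk; omega)]
    rw [h4]
    have h5 : s - 1 + ((J + 1 : ℕ) : ℂ) = s + J + 1 - 1 := by push_cast; ring
    have h6 : s + ((J + 1 : ℕ) : ℂ) + 1 = s + J + 1 + 1 := by push_cast; ring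
    rw [h5, h6, ← h2]
    ring

/-- The coefficients are left unspecified here; only the shape of the expansion is needed, as the
Mellin transform recovers them. -/
theorem powLogExpansion_id_mul_lambertExp (s : ℂ) {x : ℝ} (hx : 0 < x) (N : ℕ) :
    PowLogExpansion (-s) N fun t => t * lambertExp s x t := by
  obtain ⟨J, hJ⟩ := exists_nat_ge (max (3 - s.re) N)
  have hJ1 : 3 - s.re ≤ J := (le_max_left _ _).trans hJ
  have hJ2 : N ≤ J := by exact_mod_cast (le_max_right _ _).trans hJ
  obtain ⟨b, P, hP, hexp⟩ := exists_lambertExp_byParts s J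
  have hsum : PowLogExpansion (-s) N fun t => ∑ k ∈ Finset.range (J + 1),
      b k * ((t : ℂ) ^ k * polylogExp (s - 1 + k) (x * t)) := by
    refine PowLogExpansion.sum _ fun k _ => PowLogExpansion.const_mul _ ?_
    have h := (((powLogExpansion_polylogExp (s - 1 + k) N).comp_mul_left hx).id_pow_mul k).mono
      (Nat.le_add_right N k)
    rwa [show -(1 + (s - 1 + k)) + k = -s by ring] at h
  set S : ℂ := s + J + 1 with hSdef
  have hS : 3 ≤ S.re := by simp [hSdef]; linarith
  obtain ⟨C, hC0, hC⟩ := lambertExp_leading hS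
  set G := Complex.Gamma (1 + S) with hG
  set I : ℂ := ∫ w in (0 : ℝ)..1, P w * hurwitzZetaPos (x + w) (1 + S) with hI
  obtain ⟨D, hD⟩ := (isCompact_uIcc (a := (0 : ℝ)) (b := 1)).exists_bound_of_continuousOn
    hP.continuousOn
  have hZ : ContinuousOn (fun w => hurwitzZetaPos (x + w) (1 + S)) (Set.uIcc 0 1) := by
    refine (continuousOn_hurwitzZetaPos (s := 1 + S) (by simp; linarith)).comp (by fun_prop) ?_
    intro w hw
    rw [Set.uIcc_of_le zero_le_one] at hw
    have := hw.1
    show 0 < x + w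
    linarith
  have hrem : ∀ t : ℝ, 0 < t → t ≤ 1 →
      ‖(∫ w in (0 : ℝ)..1, P w * lambertExp S (x + w) t) - G * (t : ℂ) ^ (-(1 + S)) * I‖
        ≤ D * (C / t) := by
    intro t ht ht1
    have hPZ : IntervalIntegrable (fun w => G * (t : ℂ) ^ (-(1 + S))
        * (P w * hurwitzZetaPos (x + w) (1 + S))) MeasureTheory.volume 0 1 :=
      ContinuousOn.intervalIntegrable (continuousOn_const.mul (hP.continuousOn.mul hZ))
    rw [hI, ← intervalIntegral.integral_const_mul, ← intervalIntegral.integral_sub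
      (intervalIntegrable_mul_lambertExp hP S hx ht) hPZ]
    have h := intervalIntegral.norm_integral_le_of_norm_le_const (a := 0) (b := 1)
      (f := fun w => P w * lambertExp S (x + w) t
        - G * (t : ℂ) ^ (-(1 + S)) * (P w * hurwitzZetaPos (x + w) (1 + S))) (C := D * (C / t))
      fun w hw => ?_
    · simpa using h
    · have hw' : w ∈ Set.uIcc (0 : ℝ) 1 := Set.uIoc_subset_uIcc hw
      rw [Set.uIoc_of_le zero_le_one] at hw
      rw [show P w * lambertExp S (x + w) t
          - G * (t : ℂ) ^ (-(1 + S)) * (P w * hurwitzZetaPos (x + w) (1 + S))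
        = P w * (lambertExp S (x + w) t
          - G * (t : ℂ) ^ (-(1 + S)) * hurwitzZetaPos (x + w) (1 + S)) by ring, norm_mul]
      have := hw.1
      exact mul_le_mul (hD w hw') (hC _ _ (by linarith) ht ht1) (norm_nonneg _)
        ((norm_nonneg _).trans (hD w hw'))
  -- One power of `t` is lost to the uniform error `C / t`, and `J + 1 ≥ N` remains enough.
  have herr : (fun t : ℝ => (t : ℂ) ^ (J + 2) * ((∫ w in (0 : ℝ)..1, P w * lambertExp S (x + w) t)
      - G * (t : ℂ) ^ (-(1 + S)) * I)) =O[𝓝[>] 0] fun t : ℝ => t ^ (J + 1) := by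
    refine IsBigO.of_bound (D * C) ?_
    filter_upwards [Ioo_mem_nhdsGT one_pos] with t ht
    have ht0 := ht.1
    rw [norm_mul, norm_pow, norm_pow, Complex.norm_real, Real.norm_of_nonneg ht0.le]
    calc _ ≤ t ^ (J + 2) * (D * (C / t)) := by
          gcongr
          exact hrem t ht.1 ht.2.le
      _ = D * C * t ^ (J + 1) := by field_simp; ring
  have h1 := (hsum.add (PowLogExpansion.cpow (G * I) (-s) N)).add
    ((PowLogExpansion.of_isBigO (-s) herr).mono (by omega : N ≤ J + 1))
  refine h1.congr ?_
  filter_upwards [self_mem_nhdsWithin] with t ht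
  have ht0 : 0 < t := ht
  have ht' : (t : ℂ) ≠ 0 := by exact_mod_cast ht0.ne'
  rw [hexp x t hx ht0]
  have h2 : (t : ℂ) ^ (-s) = (t : ℂ) ^ (J + 2) * (t : ℂ) ^ (-(1 + S)) := by
    rw [← Complex.cpow_natCast, ← Complex.cpow_add _ _ ht']
    congr 1
    rw [hSdef]
    push_cast
    ring
  rw [h2]
  ring

/-! ### Mellin transforms of expansions and of the Lambert series -/

theorem HasMellin.add' {f g : ℝ → ℂ} {s a b : ℂ} (hf : HasMellin f s a) (hg : HasMellin g s b) :
    HasMellin (fun t => f t + g t) s (a + b) := by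
  rw [← hf.2, ← hg.2]
  exact hasMellin_add hf.1 hg.1

theorem HasMellin.const_mul' {f : ℝ → ℂ} {s a : ℂ} (hf : HasMellin f s a) (c : ℂ) :
    HasMellin (fun t => c * f t) s (c * a) := by
  rw [← hf.2]
  exact hasMellin_const_smul hf.1 c

theorem HasMellin.sum' {ι : Type*} (I : Finset ι) {f : ι → ℝ → ℂ} {s : ℂ} {a : ι → ℂ}
    (h : ∀ i ∈ I, HasMellin (f i) s (a i)) :
    HasMellin (fun t => ∑ i ∈ I, f i t) s (∑ i ∈ I, a i) := by
  classical
  induction I using Finset.induction_on with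
  | empty => simp [HasMellin, MellinConvergent, mellin]
  | insert j I hj ih =>
    simp only [Finset.sum_insert hj]
    exact (h j (Finset.mem_insert_self j I)).add' (ih fun i hi => h i (Finset.mem_insert_of_mem hi))

theorem locallyIntegrableOn_indicator_Ioc {p : ℝ → ℂ} (hp : ContinuousOn p (Set.Ioi 0)) :
    MeasureTheory.LocallyIntegrableOn ((Set.Ioc 0 1).indicator p) (Set.Ioi 0) := by
  intro t ht
  obtain ⟨u, hu, hi⟩ := hp.locallyIntegrableOn (μ := MeasureTheory.volume) measurableSet_Ioi t ht
  exact ⟨u, hu, hi.indicator measurableSet_Ioc⟩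

theorem continuousOn_ofReal_cpow (a : ℂ) : ContinuousOn (fun t : ℝ => (t : ℂ) ^ a) (Set.Ioi 0) :=
  fun t ht => (Complex.continuousAt_ofReal_cpow_const t a
    (Or.inr (ne_of_gt ht))).continuousWithinAt

/-- Differentiating a Mellin transform in `s` inserts `log t`, so this is the derivative of `1 / (s
+ a)`. -/
theorem hasMellin_log_cpow_Ioc (a : ℂ) {s : ℂ} (hs : 0 < s.re + a.re) :
    HasMellin (Set.indicator (Set.Ioc 0 1) fun t : ℝ => (Real.log t : ℂ) * (t : ℂ) ^ a) s
      (-(1 / (s + a) ^ 2)) := by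
  set f : ℝ → ℂ := Set.indicator (Set.Ioc 0 1) fun t : ℝ => (t : ℂ) ^ a with hf
  have htop : f =O[atTop] fun t : ℝ => t ^ (-(s.re + 1)) := by
    refine IsBigO.of_bound 1 ?_
    filter_upwards [eventually_gt_atTop 1] with t ht
    rw [hf, Set.indicator_of_notMem (fun h => not_lt.mpr h.2 ht), norm_zero]
    positivity
  have hbot : f =O[𝓝[>] 0] fun t : ℝ => t ^ (-(-a.re)) := by
    refine IsBigO.of_bound 1 ?_
    filter_upwards [Ioo_mem_nhdsGT one_pos] with t ht
    rw [hf, Set.indicator_of_mem (Set.mem_Ioc.mpr ⟨ht.1, ht.2.le⟩), Complex.norm_cpow_eq_rpow_re_of_pos ht.1, neg_neg,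
      one_mul]
    exact le_abs_self _
  have h := mellin_hasDerivAt_of_isBigO_rpow (s := s)
    (locallyIntegrableOn_indicator_Ioc (continuousOn_ofReal_cpow a)) htop (lt_add_one _) hbot
    (by linarith)
  have hfun : (fun t : ℝ => Real.log t • f t)
      = Set.indicator (Set.Ioc 0 1) fun t : ℝ => (Real.log t : ℂ) * (t : ℂ) ^ a := by
    ext t
    by_cases ht : t ∈ Set.Ioc (0 : ℝ) 1 <;> simp [hf, ht]
  rw [hfun] at h
  refine ⟨h.1, h.2.unique ?_⟩
  have hsa : s + a ≠ 0 := fun h0 => by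
    rw [← Complex.add_re, h0] at hs
    simp at hs
  have h1 : HasDerivAt (fun z : ℂ => 1 / (z + a)) (-(1 / (s + a) ^ 2)) s := by
    have := (((hasDerivAt_id s).add_const a).inv hsa)
    simp only [one_div]
    refine this.congr_deriv ?_
    simp [neg_div]
  refine h1.congr_of_eventuallyEq ?_
  have hopen : {z : ℂ | 0 < z.re + a.re} ∈ 𝓝 s :=
    (isOpen_lt continuous_const (Complex.continuous_re.add continuous_const)).mem_nhds hs
  filter_upwards [hopen] with z hz
  exact (hasMellin_cpow_Ioc a hz).2

theorem mellin_of_expansion {f : ℝ → ℂ} {a : ℝ} (ha : 0 < a) (hf : ContinuousOn f (Set.Ioi 0))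
    (htop : f =O[atTop] fun t : ℝ => Real.exp (-a * t)) {σ α β : ℂ} {c : ℕ → ℂ} {N : ℕ}
    (hO : (fun t : ℝ => f t - ((α + β * (Real.log t : ℂ)) * (t : ℂ) ^ σ
      + ∑ i ∈ Finset.range N, c i * (t : ℂ) ^ i)) =O[𝓝[>] 0] fun t : ℝ => t ^ N) :
    ∃ A : ℂ → ℂ, DifferentiableOn ℂ A {w | -(N : ℝ) < w.re} ∧
      ∀ w : ℂ, 0 < w.re → 0 < w.re + σ.re → mellin f w
        = α / (w + σ) - β / (w + σ) ^ 2 + ∑ i ∈ Finset.range N, c i / (w + i) + A w := by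
  set p : ℝ → ℂ := fun t => (α + β * (Real.log t : ℂ)) * (t : ℂ) ^ σ
      + ∑ i ∈ Finset.range N, c i * (t : ℂ) ^ i with hp
  have hpc : ContinuousOn p (Set.Ioi 0) := by
    have hlog : ContinuousOn (fun t : ℝ => (Real.log t : ℂ)) (Set.Ioi 0) :=
      Complex.continuous_ofReal.comp_continuousOn
        (Real.continuousOn_log.mono fun t ht => ne_of_gt ht)
    exact ((continuousOn_const.add (continuousOn_const.mul hlog)).mul
      (continuousOn_ofReal_cpow σ)).add (by fun_prop)
  -- Subtracting the expansion only on `(0, 1]` keeps the exponential decay at infinity while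
  -- leaving `O(t ^ N)` at zero, so the Mellin transform of `g` is holomorphic for `Re w > -N`. The
  -- subtracted pieces have explicit rational transforms.
  set g : ℝ → ℂ := fun t => f t - (Set.Ioc 0 1).indicator p t with hg
  have hgloc : MeasureTheory.LocallyIntegrableOn g (Set.Ioi 0) :=
    (hf.locallyIntegrableOn measurableSet_Ioi).sub (locallyIntegrableOn_indicator_Ioc hpc)
  have hgtop : g =O[atTop] fun t : ℝ => Real.exp (-a * t) := by
    refine htop.congr' ?_ EventuallyEq.rfl
    filter_upwards [eventually_gt_atTop 1] with t ht
    rw [hg]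
    simp only
    rw [Set.indicator_of_notMem (fun h => not_lt.mpr h.2 ht), sub_zero]
  have hgbot : g =O[𝓝[>] 0] fun t : ℝ => t ^ (-(-(N : ℝ))) := by
    refine hO.congr' ?_ ?_
    · filter_upwards [Ioo_mem_nhdsGT one_pos] with t ht
      rw [hg]
      simp only
      rw [Set.indicator_of_mem (Set.mem_Ioc.mpr ⟨ht.1, ht.2.le⟩)]
    · filter_upwards with t
      rw [neg_neg, Real.rpow_natCast]
  refine ⟨mellin g, fun w hw => (mellin_differentiableAt_of_isBigO_rpow_exp ha hgloc hgtop hgbot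
    hw).differentiableWithinAt, fun w hw hwσ => ?_⟩
  have hgM : HasMellin g w (mellin g w) :=
    ⟨mellinConvergent_of_isBigO_rpow_exp ha hgloc hgtop hgbot (by
      have := N.cast_nonneg (α := ℝ); linarith), rfl⟩
  have h1 := ((hasMellin_cpow_Ioc σ hwσ).const_mul' α).add'
    ((hasMellin_log_cpow_Ioc σ hwσ).const_mul' β)
  have h2 : HasMellin (fun t => ∑ i ∈ Finset.range N,
      c i * Set.indicator (Set.Ioc 0 1) (fun t : ℝ => (t : ℂ) ^ (i : ℂ)) t) w
      (∑ i ∈ Finset.range N, c i * (1 / (w + i))) :=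
    HasMellin.sum' _ fun i _ => (hasMellin_cpow_Ioc (i : ℂ) (by
      rw [Complex.natCast_re]; have := i.cast_nonneg (α := ℝ); linarith)).const_mul' (c i)
  have h3 := (h1.add' h2).add' hgM
  have hfun : (fun t => α * (Set.Ioc 0 1).indicator (fun t : ℝ => (t : ℂ) ^ σ) t
      + β * (Set.Ioc 0 1).indicator (fun t : ℝ => (Real.log t : ℂ) * (t : ℂ) ^ σ) t
      + ∑ i ∈ Finset.range N,
        c i * Set.indicator (Set.Ioc 0 1) (fun t : ℝ => (t : ℂ) ^ (i : ℂ)) t + g t) = f := by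
    ext t
    by_cases ht : t ∈ Set.Ioc (0 : ℝ) 1
    · simp only [hg, hp, Set.indicator_of_mem ht, Complex.cpow_natCast]
      ring
    · simp only [hg, Set.indicator_of_notMem ht]
      simp
  rw [hfun] at h3
  rw [h3.2]
  simp only [mul_one_div]
  ring

/-- Termwise integration of the double series: `k ^ s (k (n + x)) ^ (-(w + 1))` separates into a
Riemann and a Hurwitz factor. -/
theorem mellin_id_mul_lambertExp (s : ℂ) {x : ℝ} (hx : 0 < x) {w : ℂ} (hw : 0 < w.re)
    (hws : s.re < w.re) :
    mellin (fun t : ℝ => t * lambertExp s x t) w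
      = Complex.Gamma (w + 1) * hurwitzZetaPos x (w + 1) * riemannZeta (w + 1 - s) := by
  have h0 : mellin (fun t : ℝ => t * lambertExp s x t) w = mellin (lambertExp s x) (w + 1) := by
    rw [← mellin_cpow_smul]
    simp [smul_eq_mul]
  have hz := hasSum_hurwitzZetaPos hx (s := w + 1) (by simp [hw])
  have hr : HasSum (fun k : ℕ => 1 / ((k + 1 : ℕ) : ℂ) ^ (w + 1 - s)) (riemannZeta (w + 1 - s)) := by
    have hre : 1 < (w + 1 - s).re := by simp; linarith
    rw [zeta_eq_tsum_one_div_nat_add_one_cpow hre]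
    have h := (summable_nat_add_iff 1).mpr (Complex.summable_one_div_nat_cpow.mpr hre)
    simpa using h.hasSum
  have hsum := summable_mul_of_summable_norm hr.summable.norm hz.summable.norm
  have hterm : ∀ p : ℕ × ℕ, Complex.Gamma (w + 1) * ((p.1 + 1 : ℕ) : ℂ) ^ s
        / ((((p.1 + 1 : ℕ) : ℝ) * (p.2 + x) : ℝ) : ℂ) ^ (w + 1)
      = Complex.Gamma (w + 1) * (1 / ((p.1 + 1 : ℕ) : ℂ) ^ (w + 1 - s)
        * (1 / (((p.2 : ℝ) + x : ℝ) : ℂ) ^ (w + 1))) := by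
    intro p
    have hk : ((p.1 + 1 : ℕ) : ℂ) ≠ 0 := by exact_mod_cast p.1.succ_ne_zero
    have hk' : ((p.1 + 1 : ℕ) : ℂ) ^ s ≠ 0 := by
      rw [Complex.cpow_ne_zero_iff]
      exact Or.inl hk
    rw [Complex.ofReal_mul, Complex.mul_cpow_ofReal_nonneg (by positivity) (by positivity),
      Complex.cpow_sub _ _ hk, Complex.ofReal_natCast]
    field_simp
  have hM := hasSum_mellin (a := fun p : ℕ × ℕ => ((p.1 + 1 : ℕ) : ℂ) ^ s)
    (p := fun p : ℕ × ℕ => ((p.1 + 1 : ℕ) : ℝ) * (p.2 + x)) (F := lambertExp s x) (s := w + 1)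
    (fun p => Or.inr (by positivity)) (by simp; linarith)
    (fun t ht => hasSum_double_lambert s hx ht) ?_
  · simp_rw [hterm] at hM
    rw [h0, hM.unique ((hr.mul hz hsum).mul_left (Complex.Gamma (w + 1)))]
    ring
  · refine hsum.norm.congr fun p => ?_
    have hx' : 0 < (p.2 : ℝ) + x := by positivity
    have hk : (0 : ℝ) < ((p.1 + 1 : ℕ) : ℝ) := by positivity
    rw [norm_mul, norm_div, norm_div, norm_one, norm_natCast_succ_cpow, norm_natCast_succ_cpow,
      Complex.norm_cpow_eq_rpow_re_of_pos hx', Real.mul_rpow hk.le hx'.le, Complex.sub_re,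
      Real.rpow_sub hk]
    have h1 : 0 < ((p.1 + 1 : ℕ) : ℝ) ^ s.re := Real.rpow_pos_of_pos hk _
    field_simp

/-! ### Meromorphic continuation and comparison of Laurent coefficients -/

theorem meromorphic_riemannZeta : Meromorphic riemannZeta := fun s => by
  have h : MeromorphicAt (fun z : ℂ => (z - 1)⁻¹ * riemannZeta₁ z) s :=
    MeromorphicAt.mul (by fun_prop)
      (differentiable_riemannZeta₁.analyticAt s).meromorphicAt
  refine h.congr ?_
  by_cases hs : s = 1
  · subst hs
    filter_upwards [self_mem_nhdsWithin] with z hz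
    exact (riemannZeta_eq_inv_sub_mul hz).symm
  · filter_upwards [nhdsWithin_le_nhds (isOpen_ne.mem_nhds hs)] with z hz
    exact (riemannZeta_eq_inv_sub_mul hz).symm

/-- The poles at `1` cancel. As the difference is entire, its value at `1`, formed from the values
assigned at the pole, is the true limit. -/
theorem differentiable_hurwitzZetaPos_sub_riemannZeta (x : ℝ) :
    Differentiable ℂ fun s => hurwitzZetaPos x s - riemannZeta s := by
  have h1 := HurwitzZeta.differentiable_hurwitzZeta_sub_hurwitzZeta (x : UnitAddCircle) 0
  rw [HurwitzZeta.hurwitzZeta_zero] at h1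
  have h2 : Differentiable ℂ fun s : ℂ =>
      ∑ n ∈ Finset.range (⌈x⌉₊ - 1), ((x - ((n : ℝ) + 1) : ℝ) : ℂ) ^ (-s) := by
    refine Differentiable.fun_sum fun n hn s => ?_
    refine DifferentiableAt.const_cpow (by fun_prop) (Or.inl ?_)
    have hn' : n + 1 < ⌈x⌉₊ := by
      have := Finset.mem_range.mp hn
      omega
    have h1 : ((n + 1 : ℕ) : ℝ) < x := Nat.lt_ceil.mp hn'
    push_cast at h1
    exact Complex.ofReal_ne_zero.mpr (by linarith)
  have h3 := h1.fun_sub h2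
  refine (funext fun s => ?_ : (fun s => hurwitzZetaPos x s - riemannZeta s) = _) ▸ h3
  rw [hurwitzZetaPos]
  ring

theorem meromorphic_hurwitzZetaPos (x : ℝ) : Meromorphic (hurwitzZetaPos x) := fun s => by
  have h := (((differentiable_hurwitzZetaPos_sub_riemannZeta x).analyticAt s).meromorphicAt).add
    (meromorphic_riemannZeta s)
  convert h using 1
  ext z
  simp

/-- The Mellin transform of `t ↦ t * lambertExp s x t`. -/
noncomputable def lambertMellin (s : ℂ) (x : ℝ) (w : ℂ) : ℂ :=
  Complex.Gamma (w + 1) * hurwitzZetaPos x (w + 1) * riemannZeta (w + 1 - s)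

theorem meromorphic_lambertMellin (s : ℂ) (x : ℝ) : Meromorphic (lambertMellin s x) := fun w => by
  have h1 : MeromorphicAt (fun w => Complex.Gamma (w + 1)) w :=
    (Meromorphic.Gamma (w + 1)).comp_analyticAt (f := Complex.Gamma) (g := fun w => w + 1) (by fun_prop)
  have h2 : MeromorphicAt (fun w => hurwitzZetaPos x (w + 1)) w :=
    (meromorphic_hurwitzZetaPos x (w + 1)).comp_analyticAt (g := fun w => w + 1) (by fun_prop)
  have h3 : MeromorphicAt (fun w => riemannZeta (w + 1 - s)) w :=
    (meromorphic_riemannZeta (w + 1 - s)).comp_analyticAt (g := fun w => w + 1 - s) (by fun_prop)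
  exact (h1.mul h2).mul h3

/-- The identity theorem: on a connected set, a meromorphic function of infinite order at one point
has infinite order at every point. The conclusion is on a punctured neighbourhood because values at
poles carry no information. -/
theorem eventually_eq_of_meromorphicOn_halfPlane {F G : ℂ → ℂ} {b B : ℝ}
    (hF : MeromorphicOn F {w | b < w.re}) (hG : MeromorphicOn G {w | b < w.re})
    (h : ∀ w : ℂ, B < w.re → F w = G w) {w₀ : ℂ} (hw : b < w₀.re) :
    F =ᶠ[𝓝[≠] w₀] G := by
  have hD := hF.sub hG
  by_contra hne
  have hord : meromorphicOrderAt (F - G) w₀ ≠ ⊤ := fun htop => by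
    refine hne ?_
    filter_upwards [meromorphicOrderAt_eq_top_iff.mp htop] with z hz
    exact sub_eq_zero.mp hz
  set y : ℂ := ((max b B + 1 : ℝ) : ℂ) with hy
  have hyb : b < y.re := by
    rw [hy, Complex.ofReal_re]
    linarith [le_max_left b B]
  have hyB : B < y.re := by
    rw [hy, Complex.ofReal_re]
    linarith [le_max_right b B]
  refine hD.meromorphicOrderAt_ne_top_of_isPreconnected (convex_halfSpace_re_gt b).isPreconnected
    hw hyb hord ?_
  rw [meromorphicOrderAt_eq_top_iff]
  filter_upwards [nhdsWithin_le_nhds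
    ((isOpen_lt continuous_const Complex.continuous_re).mem_nhds hyB)] with z hz
  exact sub_eq_zero.mpr (h z hz)

theorem hasDerivAt_sq_mul {F : ℂ → ℂ} {w₀ : ℂ} (hF : DifferentiableAt ℂ F w₀) :
    HasDerivAt (fun w => (w - w₀) ^ 2 * F w) 0 w₀ := by
  refine ((((hasDerivAt_id' w₀).sub_const w₀).fun_pow 2).fun_mul hF.hasDerivAt).congr_deriv ?_
  simp

/-- After multiplication by `(w - w₀) ^ 2`, the value at `w₀` is the coefficient of `(w - w₀) ^
(-2)` and the derivative is the residue. `K` is the product with its removable singularity filled.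
-/
theorem exists_hasDerivAt_sq_mul_inv (w₀ b : ℂ) :
    ∃ K : ℂ → ℂ, K w₀ = 0 ∧ HasDerivAt K (if w₀ = -b then 1 else 0) w₀ ∧
      ∀ w, w ≠ w₀ → K w = (w - w₀) ^ 2 * (1 / (w + b)) := by
  by_cases h : w₀ = -b
  · refine ⟨fun w => w - w₀, by simp, by simpa [h] using (hasDerivAt_id w₀).sub_const w₀,
      fun w hw => ?_⟩
    have : w - w₀ ≠ 0 := sub_ne_zero.mpr hw
    rw [show w + b = w - w₀ by rw [h]; ring]
    field_simp
  · have hb : w₀ + b ≠ 0 := fun h0 => h (eq_neg_of_add_eq_zero_left h0)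
    refine ⟨fun w => (w - w₀) ^ 2 * (1 / (w + b)), by simp, ?_, fun w _ => rfl⟩
    have h2 : DifferentiableAt ℂ (fun w : ℂ => 1 / (w + b)) w₀ :=
      DifferentiableAt.div (by fun_prop) (by fun_prop) hb
    simpa only [h, if_false] using hasDerivAt_sq_mul h2

theorem exists_hasDerivAt_sq_mul_inv_sq (w₀ b : ℂ) :
    ∃ K : ℂ → ℂ, K w₀ = (if w₀ = -b then 1 else 0) ∧ HasDerivAt K 0 w₀ ∧
      ∀ w, w ≠ w₀ → K w = (w - w₀) ^ 2 * (1 / (w + b) ^ 2) := by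
  by_cases h : w₀ = -b
  · refine ⟨fun _ => 1, by simp [h], hasDerivAt_const _ _, fun w hw => ?_⟩
    have : w - w₀ ≠ 0 := sub_ne_zero.mpr hw
    rw [show w + b = w - w₀ by rw [h]; ring]
    field_simp
  · have hb : w₀ + b ≠ 0 := fun h0 => h (eq_neg_of_add_eq_zero_left h0)
    refine ⟨fun w => (w - w₀) ^ 2 * (1 / (w + b) ^ 2), by simp [h], ?_, fun w _ => rfl⟩
    have h2 : DifferentiableAt ℂ (fun w : ℂ => 1 / (w + b) ^ 2) w₀ :=
      DifferentiableAt.div (by fun_prop) (by fun_prop) (pow_ne_zero 2 hb)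
    exact hasDerivAt_sq_mul h2

theorem eq_and_deriv_eq_of_eventuallyEq_punctured {H K : ℂ → ℂ} {h k w₀ : ℂ}
    (hH : HasDerivAt H h w₀) (hK : HasDerivAt K k w₀) (hHK : H =ᶠ[𝓝[≠] w₀] K) :
    H w₀ = K w₀ ∧ h = k := by
  have h1 : H =ᶠ[𝓝 w₀] K :=
    hH.continuousAt.eventuallyEq_nhds_iff_eventuallyEq_nhdsNE hK.continuousAt |>.mp hHK
  exact ⟨h1.eq_of_nhds, (hH.congr_of_eventuallyEq h1.symm).unique hK⟩

/-- The Laurent coefficients of the Mellin transform determine the expansion. -/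
theorem expansion_coeff_lambertExp {s : ℂ} {x : ℝ} (hx : 0 < x) {α β : ℂ} {c : ℕ → ℂ} {N : ℕ}
    (hO : (fun t : ℝ => t * lambertExp s x t - ((α + β * (Real.log t : ℂ)) * (t : ℂ) ^ (-s)
      + ∑ i ∈ Finset.range N, c i * (t : ℂ) ^ i)) =O[𝓝[>] 0] fun t : ℝ => t ^ N)
    {w₀ : ℂ} (hw : -(N : ℝ) < w₀.re) {H : ℂ → ℂ} {d : ℂ} (hH : HasDerivAt H d w₀)
    (hHL : ∀ᶠ w in 𝓝[≠] w₀, H w = (w - w₀) ^ 2 * lambertMellin s x w) :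
    H w₀ = -(if w₀ = s then β else 0) ∧
      d = (if w₀ = s then α else 0) + ∑ i ∈ Finset.range N, if w₀ = -(i : ℂ) then c i else 0 := by
  -- The rate drops from `x / 2` to `x / 4` to absorb the factor `t`.
  have htop : (fun t : ℝ => t * lambertExp s x t) =O[atTop] fun t => Real.exp (-(x / 4) * t) := by
    have h1 : (fun t : ℝ => (t : ℂ)) =O[atTop] fun t : ℝ => Real.exp (x / 4 * t) := by
      have h2 := (isLittleO_pow_exp_pos_mul_atTop 1 (by linarith : 0 < x / 4)).isBigO
      refine IsBigO.trans (IsBigO.of_bound 1 (Eventually.of_forall fun t => ?_)) h2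
      simp
    refine (h1.mul (lambertExp_isBigO_atTop s hx)).congr_right fun t => ?_
    rw [← Real.exp_add]
    congr 1
    ring
  have hcont : ContinuousOn (fun t : ℝ => t * lambertExp s x t) (Set.Ioi 0) :=
    Complex.continuous_ofReal.continuousOn.mul (continuousOn_lambertExp s hx)
  obtain ⟨A, hA, hM⟩ := mellin_of_expansion (by linarith : 0 < x / 4) hcont htop hO
  have hU : IsOpen {w : ℂ | -(N : ℝ) < w.re} := isOpen_lt continuous_const Complex.continuous_re
  have hAan : AnalyticOnNhd ℂ A {w | -(N : ℝ) < w.re} := hA.analyticOnNhd hU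
  have hG : MeromorphicOn (fun w => α / (w + -s) - β / (w + -s) ^ 2
      + ∑ i ∈ Finset.range N, c i / (w + i) + A w) {w | -(N : ℝ) < w.re} := by
    intro w hw
    have := (hAan w hw).meromorphicAt
    fun_prop
  have hev : lambertMellin s x =ᶠ[𝓝[≠] w₀] fun w => α / (w + -s) - β / (w + -s) ^ 2
      + ∑ i ∈ Finset.range N, c i / (w + i) + A w := by
    refine eventually_eq_of_meromorphicOn_halfPlane (B := max 0 s.re)
      (meromorphic_lambertMellin s x).meromorphicOn hG (fun w hw => ?_) hw
    have h1 : 0 < w.re := (le_max_left _ _).trans_lt hw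
    have h2 : s.re < w.re := (le_max_right _ _).trans_lt hw
    rw [lambertMellin, ← mellin_id_mul_lambertExp s hx h1 h2]
    exact hM w h1 (by rw [Complex.neg_re]; linarith)
  obtain ⟨K₁, hK₁0, hK₁d, hK₁⟩ := exists_hasDerivAt_sq_mul_inv w₀ (-s)
  obtain ⟨K₂, hK₂0, hK₂d, hK₂⟩ := exists_hasDerivAt_sq_mul_inv_sq w₀ (-s)
  choose K₃ hK₃0 hK₃d hK₃ using fun i : ℕ => exists_hasDerivAt_sq_mul_inv w₀ (i : ℂ)
  have hK₄ : HasDerivAt (fun w => (w - w₀) ^ 2 * A w) 0 w₀ :=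
    hasDerivAt_sq_mul (hA.differentiableAt (hU.mem_nhds hw))
  have hK := (((hK₁d.const_mul α).sub (hK₂d.const_mul β)).add
    (HasDerivAt.fun_sum (u := Finset.range N) fun i _ => (hK₃d i).const_mul (c i))).add hK₄
  obtain ⟨h1, h2⟩ := eq_and_deriv_eq_of_eventuallyEq_punctured hH hK (by
    filter_upwards [hHL, hev, self_mem_nhdsWithin] with w hw1 hw2 hw3
    rw [hw1, hw2]
    simp only [Pi.add_apply, Pi.sub_apply, hK₁ w hw3, hK₂ w hw3, hK₃ _ w hw3]
    rw [mul_add, mul_add, Finset.mul_sum]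
    congr 2
    · ring
    · exact Finset.sum_congr rfl fun i _ => by ring)
  refine ⟨?_, ?_⟩
  · rw [h1]
    simp [hK₁0, hK₂0, hK₃0]
  · rw [h2]
    simp

/-! ### Hurwitz zeta values at nonpositive integers -/

section HurwitzValues

theorem hurwitzZetaPos_of_le_one {x : ℝ} (hx : 0 < x) (hx1 : x ≤ 1) (s : ℂ) :
    hurwitzZetaPos x s = HurwitzZeta.hurwitzZeta (x : UnitAddCircle) s := by
  have h : ⌈x⌉₊ = 1 := by
    refine le_antisymm (Nat.ceil_le.mpr (by exact_mod_cast hx1)) (Nat.ceil_pos.mpr hx)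
  simp [hurwitzZetaPos, h]

theorem hurwitzZetaPos_add_one {x : ℝ} (hx : 0 < x) (s : ℂ) :
    hurwitzZetaPos (x + 1) s = hurwitzZetaPos x s - (x : ℂ) ^ (-s) := by
  obtain ⟨n, hn⟩ : ∃ n, ⌈x⌉₊ = n + 1 := ⟨⌈x⌉₊ - 1, by have := Nat.ceil_pos.mpr hx; omega⟩
  have h1 : ((x + 1 : ℝ) : UnitAddCircle) = (x : UnitAddCircle) := AddCircle.coe_add_period 1 x
  rw [hurwitzZetaPos, hurwitzZetaPos, h1, Nat.ceil_add_one hx.le, hn, Nat.add_sub_cancel,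
    Nat.add_sub_cancel, Finset.sum_range_succ', sub_sub]
  congr 2
  · refine Finset.sum_congr rfl fun i _ => ?_
    congr 2
    push_cast
    ring
  · congr 2
    simp

theorem hurwitzZetaPos_one (s : ℂ) : hurwitzZetaPos 1 s = riemannZeta s := by
  rw [hurwitzZetaPos_of_le_one one_pos le_rfl, ← HurwitzZeta.hurwitzZeta_zero]
  congr 1
  simp

theorem bernoulliFun_add_one (n : ℕ) (x : ℝ) :
    bernoulliFun n (x + 1) = bernoulliFun n x + n * x ^ (n - 1) := by
  have h := congrArg (fun p => (p.map (algebraMap ℚ ℝ)).eval x) (Polynomial.bernoulli_comp_one_add_X n)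
  simp only [Polynomial.map_comp, Polynomial.eval_comp, Polynomial.map_add, Polynomial.eval_add,
    Polynomial.map_one, Polynomial.map_X, Polynomial.eval_one, Polynomial.eval_X] at h
  rw [bernoulliFun, bernoulliFun, add_comm x 1, h]
  simp

theorem lambertWeight_zero_expansion (x : ℝ) :
    (fun t : ℝ => t * lambertWeight 0 x t - (1 + (1 / 2 - x) * t)) =O[𝓝[>] 0]
      fun t : ℝ => t ^ 2 := by
  have hexp : ∀ n : ℕ, ∀ a : ℝ, (fun t : ℝ => Real.exp (-a * t)
      - ∑ m ∈ Finset.range n, (-a * t) ^ m / m.factorial) =O[𝓝[>] 0] fun t : ℝ => t ^ n := by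
    intro n a
    have h1 : Tendsto (fun t : ℝ => -a * t) (𝓝[>] 0) (𝓝 0) := by
      have : Tendsto (fun t : ℝ => -a * t) (𝓝 0) (𝓝 (-a * 0)) := (continuous_const_mul _).tendsto 0
      rw [mul_zero] at this
      exact this.mono_left nhdsWithin_le_nhds
    refine ((Real.exp_sub_sum_range_isBigO_pow n).comp_tendsto h1).trans ?_
    refine IsBigO.of_bound (‖a‖ ^ n) (Eventually.of_forall fun t => ?_)
    simp [mul_pow]
  have hone : ∀ p : ℝ → ℝ, Continuous p → p =O[𝓝[>] 0] fun _ : ℝ => (1 : ℝ) := fun p hp =>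
    ((hp.tendsto 0).mono_left nhdsWithin_le_nhds).isBigO_one ℝ
  have h1 := (isBigO_refl (fun t : ℝ => t) (𝓝[>] 0)).mul (hexp 2 x)
  have h2 := (hone (fun t => 1 + (1 / 2 - x) * t) (by fun_prop)).mul (hexp 3 1)
  -- After multiplying through by `1 - exp (-t)`, the terms in `t` and `t ^ 2` cancel and this cubic
  -- term is left besides the Taylor remainders.
  have h3 : (fun t : ℝ => (1 / 2 - x) / 2 * t ^ 3) =O[𝓝[>] 0] fun t : ℝ => t ^ 3 :=
    (isBigO_refl _ _).const_mul_left _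
  have hinv : (fun t : ℝ => (1 - Real.exp (-1 * t))⁻¹) =O[𝓝[>] 0] fun t : ℝ => t⁻¹ := by
    refine IsBigO.of_bound 2 ?_
    filter_upwards [Ioo_mem_nhdsGT one_pos] with t ht
    have h4 : Real.exp (-1 * t) ≤ (1 + t)⁻¹ := by
      rw [neg_one_mul, Real.exp_neg]
      exact inv_anti₀ (by linarith [ht.1]) (by linarith [Real.add_one_le_exp t])
    have h5 : t / 2 ≤ 1 - (1 + t)⁻¹ := by
      have ht1 := ht.1
      have ht2 := ht.2
      have : 1 - (1 + t)⁻¹ = t / (1 + t) := by field_simp; ring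
      rw [this]
      gcongr
      linarith
    have ht1 := ht.1
    rw [norm_inv, norm_inv, Real.norm_of_nonneg (by linarith), Real.norm_of_nonneg ht.1.le]
    calc (1 - Real.exp (-1 * t))⁻¹ ≤ (t / 2)⁻¹ := inv_anti₀ (by positivity) (by linarith)
      _ = 2 * t⁻¹ := by field_simp
  have h4 := ((h1.congr_right fun t => (by ring : t * t ^ 2 = t ^ 3)).add
    (h2.congr_right fun t => one_mul _)).add h3
  refine (h4.mul hinv).congr' ?_ ?_
  · filter_upwards [self_mem_nhdsWithin] with t ht
    have ht' : 0 < t := ht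
    have h6 : 1 - Real.exp (-1 * t) ≠ 0 := by
      have : Real.exp (-1 * t) < 1 := Real.exp_lt_one_iff.mpr (by linarith)
      linarith
    rw [lambertWeight]
    simp only [zero_add, Nat.cast_one, Finset.sum_range_succ, Finset.sum_range_zero,
      Nat.factorial, pow_zero, pow_one, Nat.mul_one]
    rw [show -1 * (x * t) = -x * t by ring]
    generalize Real.exp (-x * t) = E
    generalize Real.exp (-1 * t) = F at h6
    push_cast
    field_simp
    ring
  · filter_upwards [self_mem_nhdsWithin] with t ht
    have ht' : 0 < t := ht
    field_simp

theorem hasSum_lambertWeight_zero {x t : ℝ} (ht : 0 < t) :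
    HasSum (fun n : ℕ => Real.exp (-(n + x) * t)) (lambertWeight 0 x t) := by
  have h1 : Real.exp (-t) < 1 := Real.exp_lt_one_iff.mpr (by linarith)
  have h2 := (hasSum_geometric_of_lt_one (Real.exp_pos _).le h1).mul_left (Real.exp (-(x * t)))
  rw [lambertWeight, div_eq_mul_inv]
  simp only [zero_add, Nat.cast_one, neg_one_mul]
  refine h2.congr_fun fun n => ?_
  rw [← Real.exp_nat_mul, ← Real.exp_add]
  congr 1
  ring

theorem mellin_id_mul_lambertWeight_zero {x : ℝ} (hx : 0 < x) {w : ℂ} (hw : 0 < w.re) :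
    mellin (fun t : ℝ => t * (lambertWeight 0 x t : ℂ)) w
      = Complex.Gamma (w + 1) * hurwitzZetaPos x (w + 1) := by
  have h0 : mellin (fun t : ℝ => t * (lambertWeight 0 x t : ℂ)) w
      = mellin (fun t : ℝ => (lambertWeight 0 x t : ℂ)) (w + 1) := by
    rw [← mellin_cpow_smul]
    simp [smul_eq_mul]
  have hz := hasSum_hurwitzZetaPos hx (s := w + 1) (by simp [hw])
  have hM := hasSum_mellin (a := fun _ : ℕ => (1 : ℂ)) (p := fun n : ℕ => (n : ℝ) + x)
    (F := fun t : ℝ => (lambertWeight 0 x t : ℂ)) (s := w + 1)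
    (fun p => Or.inr (by positivity)) (by simp; linarith)
    (fun t ht => by
      simp only [one_mul]
      exact_mod_cast Complex.hasSum_ofReal.mpr (hasSum_lambertWeight_zero (x := x) ht)) ?_
  · rw [h0, hM.unique ((hz.mul_left (Complex.Gamma (w + 1))).congr_fun fun n => by
      rw [mul_one, mul_one_div])]
  · refine hz.summable.norm.congr fun n => ?_
    rw [norm_div, norm_one, Complex.norm_cpow_eq_rpow_re_of_pos (by positivity)]

theorem continuousOn_lambertWeight (k : ℕ) (x : ℝ) :
    ContinuousOn (lambertWeight k x) (Set.Ioi 0) := by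
  refine ContinuousOn.div (by fun_prop) (by fun_prop) (fun t ht => ?_)
  have ht' : 0 < t := ht
  have : Real.exp (-((k + 1 : ℕ) : ℝ) * t) < 1 := by
    apply Real.exp_lt_one_iff.mpr
    have : 0 < ((k + 1 : ℕ) : ℝ) * t := by positivity
    linarith
  linarith

theorem lambertWeight_zero_isBigO_atTop (x : ℝ) :
    lambertWeight 0 x =O[atTop] fun t => Real.exp (-x * t) := by
  refine IsBigO.of_bound (1 - Real.exp (-1))⁻¹ ?_
  filter_upwards [eventually_ge_atTop 1] with t ht
  refine (lambertWeight_bound 0 x one_pos ht).trans (le_of_eq ?_)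
  rw [Real.norm_of_nonneg (Real.exp_pos _).le, mul_comm]
  congr 2
  push_cast
  ring

/-- The Mellin comparison in miniature, for the single sum `∑ exp (-(n + x) t)`: the residue at `w =
-1` of `Γ(w + 1) ζ(w + 1, x)` is `ζ(0, x)`, and it equals the coefficient of `t` in `t exp (-x t) /
(1 - exp (-t))`. -/
theorem hurwitzZetaPos_zero {x : ℝ} (hx : 0 < x) : hurwitzZetaPos x 0 = 1 / 2 - x := by
  set f : ℝ → ℂ := fun t => t * (lambertWeight 0 x t : ℂ) with hf
  have htop : f =O[atTop] fun t => Real.exp (-(x / 2) * t) := by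
    have h1 : (fun t : ℝ => (t : ℂ)) =O[atTop] fun t : ℝ => Real.exp (x / 2 * t) := by
      have h2 := (isLittleO_pow_exp_pos_mul_atTop 1 (by linarith : 0 < x / 2)).isBigO
      refine IsBigO.trans (IsBigO.of_bound 1 (Eventually.of_forall fun t => ?_)) h2
      simp
    have h3 : (fun t : ℝ => (lambertWeight 0 x t : ℂ)) =O[atTop] fun t => Real.exp (-x * t) :=
      (IsBigO.of_bound 1 (Eventually.of_forall fun t => by simp)).trans
        (lambertWeight_zero_isBigO_atTop x)
    refine (h1.mul h3).congr_right fun t => ?_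
    rw [← Real.exp_add]
    congr 1
    ring
  have hcont : ContinuousOn f (Set.Ioi 0) := Complex.continuous_ofReal.continuousOn.mul
    (Complex.continuous_ofReal.comp_continuousOn (continuousOn_lambertWeight 0 x))
  have hO : (fun t : ℝ => f t - ((0 + 0 * (Real.log t : ℂ)) * (t : ℂ) ^ (0 : ℂ)
      + ∑ i ∈ Finset.range 2, (if i = 0 then 1 else 1 / 2 - (x : ℂ)) * (t : ℂ) ^ i))
      =O[𝓝[>] 0] fun t : ℝ => t ^ 2 := by
    refine IsBigO.trans (IsBigO.of_bound 1 (Eventually.of_forall fun t => ?_))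
      (lambertWeight_zero_expansion x)
    rw [one_mul, ← Complex.norm_real]
    apply le_of_eq
    congr 1
    simp [hf, Finset.sum_range_succ]
  obtain ⟨A, hA, hM⟩ := mellin_of_expansion (by linarith : 0 < x / 2) hcont htop hO
  have hU : IsOpen {w : ℂ | -((2 : ℕ) : ℝ) < w.re} :=
    isOpen_lt continuous_const Complex.continuous_re
  have hAan : AnalyticOnNhd ℂ A {w | -((2 : ℕ) : ℝ) < w.re} := hA.analyticOnNhd hU
  have hmem : (-1 : ℂ) ∈ {w : ℂ | -((2 : ℕ) : ℝ) < w.re} := by simp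
  have hG : MeromorphicOn (fun w : ℂ => 1 / w + (1 / 2 - (x : ℂ)) / (w + 1) + A w)
      {w | -((2 : ℕ) : ℝ) < w.re} := by
    intro w hw
    have := (hAan w hw).meromorphicAt
    fun_prop
  have hF : MeromorphicOn (fun w : ℂ => Complex.Gamma (w + 1) * hurwitzZetaPos x (w + 1))
      {w | -((2 : ℕ) : ℝ) < w.re} := by
    intro w _
    have h1 : MeromorphicAt (fun w => Complex.Gamma (w + 1)) w :=
      (Meromorphic.Gamma (w + 1)).comp_analyticAt (f := Complex.Gamma) (g := fun w => w + 1)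
        (by fun_prop)
    have h2 : MeromorphicAt (fun w => hurwitzZetaPos x (w + 1)) w :=
      (meromorphic_hurwitzZetaPos x (w + 1)).comp_analyticAt (g := fun w => w + 1) (by fun_prop)
    exact h1.mul h2
  have hev := eventually_eq_of_meromorphicOn_halfPlane (B := 0) hF hG (fun w hw => by
    rw [← mellin_id_mul_lambertWeight_zero hx hw, hM w hw (by simpa using hw)]
    simp [Finset.sum_range_succ]) hmem
  -- Multiplying by `w + 1` removes the pole, since `(w + 1) Γ(w + 1) = Γ(w + 2)`.
  have hL : ContinuousAt (fun w : ℂ => Complex.Gamma (w + 1 + 1) * hurwitzZetaPos x (w + 1)) (-1) := by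
    refine ContinuousAt.mul ?_ ?_
    · have : ContinuousAt Complex.Gamma (-1 + 1 + 1) := by
        rw [neg_add_cancel, zero_add]
        exact Complex.hasDerivAt_Gamma_one.continuousAt
      exact this.comp (f := fun w : ℂ => w + 1 + 1) (by fun_prop)
    · have : ContinuousAt (hurwitzZetaPos x) (-1 + 1) :=
        (differentiableAt_hurwitzZetaPos (by simp)).continuousAt
      exact this.comp (f := fun w : ℂ => w + 1) (by fun_prop)
  have hR : ContinuousAt (fun w : ℂ => (w + 1) * (1 / w + A w) + (1 / 2 - (x : ℂ))) (-1) := by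
    have := (hAan _ hmem).continuousAt
    have h2 : ContinuousAt (fun w : ℂ => 1 / w) (-1) :=
      continuousAt_const.div continuousAt_id (by simp)
    fun_prop
  have hLR := (hL.eventuallyEq_nhds_iff_eventuallyEq_nhdsNE hR).mp (by
    filter_upwards [hev, self_mem_nhdsWithin,
      nhdsWithin_le_nhds (isOpen_ne.mem_nhds (by simp : (-1 : ℂ) ≠ 0))] with w hw hw1 hw0
    have hw1' : w + 1 ≠ 0 := fun h => hw1 (by
      rw [Set.mem_singleton_iff]; exact eq_neg_of_add_eq_zero_left h)
    rw [Complex.Gamma_add_one _ hw1', mul_assoc, hw]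
    field_simp
    ring)
  simpa using hLR.eq_of_nhds

/-- For `k > 0` the formula is known on `(0, 1]`; both sides obey the same difference equation in
`x`, which carries it to each interval `(n, n + 1]`. -/
theorem hurwitzZetaPos_neg_nat {x : ℝ} (hx : 0 < x) (k : ℕ) :
    hurwitzZetaPos x (-k) = -(bernoulliFun (k + 1) x : ℂ) / (k + 1) := by
  rcases Nat.eq_zero_or_pos k with rfl | hk
  · rw [Nat.cast_zero, neg_zero, hurwitzZetaPos_zero hx, zero_add, bernoulliFun_one]
    push_cast
    ring
  · have key : ∀ n : ℕ, ∀ y : ℝ, n < y → y ≤ n + 1 →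
        hurwitzZetaPos y (-k) = -(bernoulliFun (k + 1) y : ℂ) / (k + 1) := by
      intro n
      induction n with
      | zero =>
        intro y hy hy1
        rw [Nat.cast_zero] at hy hy1
        rw [zero_add] at hy1
        rw [hurwitzZetaPos_of_le_one hy hy1,
          HurwitzZeta.hurwitzZeta_neg_nat hk.ne' ⟨hy.le, hy1⟩]
        have : Polynomial.eval (y : ℂ) (Polynomial.map (algebraMap ℚ ℂ)
            (Polynomial.bernoulli (k + 1))) = (bernoulliFun (k + 1) y : ℂ) := by
          rw [bernoulliFun, Polynomial.eval_map_algebraMap, Polynomial.eval_map_algebraMap]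
          exact Polynomial.aeval_algebraMap_apply ℂ y _
        rw [this]
        ring
      | succ n ih =>
        intro y hy hy1
        push_cast at hy hy1
        have hn := n.cast_nonneg (α := ℝ)
        have h1 := ih (y - 1) (by linarith) (by linarith)
        have h2 := hurwitzZetaPos_add_one (by linarith : 0 < y - 1) (-k)
        have h3 := bernoulliFun_add_one (k + 1) (y - 1)
        rw [sub_add_cancel] at h2 h3
        rw [h2, h1, h3, neg_neg, Complex.cpow_natCast]
        have : (k : ℂ) + 1 ≠ 0 := Nat.cast_add_one_ne_zero k
        push_cast
        field_simp
        ring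
    obtain ⟨n, hn⟩ : ∃ n, ⌈x⌉₊ = n + 1 := ⟨⌈x⌉₊ - 1, by have := Nat.ceil_pos.mpr hx; omega⟩
    refine key n x (Nat.lt_ceil.mp (by omega)) ?_
    have := Nat.le_ceil x
    rw [hn] at this
    exact_mod_cast this

end HurwitzValues

/-! ### The constant term of the Hurwitz zeta function at its pole -/

section Digamma

/-- The Bohr–Mollerup argument for the digamma recursion: `g₁ - g₂` is `1`-periodic and vanishes at
positive integers. Far out, monotonicity traps both functions between consecutive integers, where
they increase only by the reciprocal. -/
theorem le_of_monotoneOn_of_add_one {g₁ g₂ : ℝ → ℝ}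
    (h₁ : ∀ x, 0 < x → g₁ (x + 1) = g₁ x + 1 / x) (h₂ : ∀ x, 0 < x → g₂ (x + 1) = g₂ x + 1 / x)
    (m₁ : MonotoneOn g₁ (Set.Ioi 0)) (m₂ : MonotoneOn g₂ (Set.Ioi 0)) (h : g₁ 1 = g₂ 1)
    {x : ℝ} (hx : 0 < x) : g₁ x ≤ g₂ x := by
  have hper : ∀ n : ℕ, ∀ y, 0 < y → g₁ (y + n) - g₂ (y + n) = g₁ y - g₂ y := by
    intro n
    induction n with
    | zero => intro y _; simp
    | succ n ih =>
      intro y hy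
      have hy' : 0 < y + n := by positivity
      rw [← ih y hy]
      push_cast
      rw [← add_assoc, h₁ _ hy', h₂ _ hy']
      ring
  obtain ⟨m, hm⟩ : ∃ m, ⌈x⌉₊ = m + 1 := ⟨⌈x⌉₊ - 1, by have := Nat.ceil_pos.mpr hx; omega⟩
  have hm1 : (m : ℝ) < x := Nat.lt_ceil.mp (by omega)
  have hm2 : x ≤ m + 1 := by
    have := Nat.le_ceil x
    rw [hm] at this
    exact_mod_cast this
  have hm0 := m.cast_nonneg (α := ℝ)
  have hbound : ∀ n : ℕ, g₁ x - g₂ x ≤ 1 / ((n : ℝ) + 1) := by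
    intro n
    have hn := n.cast_nonneg (α := ℝ)
    have e1 := hper (n + 1) x hx
    have e2 := hper (n + m) 1 one_pos
    rw [h, sub_self] at e2
    push_cast at e1 e2
    have hpos : (0 : ℝ) < 1 + (n + m) := by positivity
    have a1 := m₁ (show x + (n + 1) ∈ Set.Ioi (0 : ℝ) by show (0 : ℝ) < _; positivity)
      (show (1 + (n + m) + 1 : ℝ) ∈ Set.Ioi (0 : ℝ) by show (0 : ℝ) < _; positivity) (by linarith)
    have a2 := m₂ (show (1 + (n + m) : ℝ) ∈ Set.Ioi (0 : ℝ) from hpos)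
      (show x + (n + 1) ∈ Set.Ioi (0 : ℝ) by show (0 : ℝ) < _; positivity) (by linarith)
    rw [h₁ _ hpos] at a1
    have a3 : 1 / (1 + (n + m) : ℝ) ≤ 1 / ((n : ℝ) + 1) :=
      one_div_le_one_div_of_le (by positivity) (by linarith)
    linarith
  have := ge_of_tendsto' (tendsto_one_div_add_atTop_nhds_zero_nat (𝕜 := ℝ)) hbound
  linarith

theorem digamma_ofReal {x : ℝ} (hx : 0 < x) :
    Complex.digamma (x : ℂ) = ((deriv (Real.log ∘ Real.Gamma) x : ℝ) : ℂ) := by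
  have hne : ∀ m : ℕ, x ≠ -m := fun m h => by
    have := m.cast_nonneg (α := ℝ)
    linarith
  have h1 := (Real.differentiableAt_Gamma hne).hasDerivAt
  have h2 : HasDerivAt (fun y : ℝ => Complex.Gamma (y : ℂ)) (deriv Complex.Gamma x) x :=
    (Complex.differentiableAt_Gamma (x : ℂ) fun m h => hne m (by exact_mod_cast h)).hasDerivAt.comp_ofReal
  simp only [Complex.Gamma_ofReal] at h2
  have h3 := h2.unique h1.ofReal_comp
  have h4 := h1.log (Real.Gamma_pos_of_pos hx).ne'
  have h5 : deriv (Real.log ∘ Real.Gamma) x = deriv Real.Gamma x / Real.Gamma x := h4.deriv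
  rw [h5, Complex.digamma_def, logDeriv_apply, h3, Complex.Gamma_ofReal]
  push_cast
  rfl

theorem tendsto_hurwitzZetaPos_sub_riemannZeta (x : ℝ) :
    Tendsto (fun σ : ℝ => hurwitzZetaPos x (σ : ℂ) - riemannZeta (σ : ℂ)) (𝓝[>] 1)
      (𝓝 (hurwitzZetaPos x 1 - riemannZeta 1)) := by
  have h := ((differentiable_hurwitzZetaPos_sub_riemannZeta x).continuous.comp
    Complex.continuous_ofReal).tendsto 1
  simp only [Function.comp_apply, Complex.ofReal_one] at h
  exact h.mono_left nhdsWithin_le_nhds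

theorem hasSum_hurwitzZetaPos_ofReal {x σ : ℝ} (hx : 0 < x) (hσ : 1 < σ) :
    HasSum (fun n : ℕ => 1 / ((n : ℝ) + x) ^ σ) (hurwitzZetaPos x σ).re ∧
      (hurwitzZetaPos x σ).im = 0 := by
  have h := hasSum_hurwitzZetaPos hx (s := (σ : ℂ)) (by simpa using hσ)
  have h1 : ∀ n : ℕ, (1 : ℂ) / (((n : ℝ) + x : ℝ) : ℂ) ^ (σ : ℂ)
      = ((1 / ((n : ℝ) + x) ^ σ : ℝ) : ℂ) := fun n => by
    rw [← Complex.ofReal_cpow (by positivity)]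
    push_cast
    rfl
  simp_rw [h1] at h
  refine ⟨by simpa using Complex.hasSum_re h, ?_⟩
  have h2 := Complex.hasSum_im h
  simp only [Complex.ofReal_im] at h2
  exact h2.unique hasSum_zero

/-- Uniqueness for the digamma recursion: `ψ` is monotone by log-convexity of `Γ`, the candidate is
monotone because each term `(n + x) ^ (-σ)` decreases in `x` (then `σ → 1+`), and both equal `-γ` at
`1`. -/
theorem hurwitzZetaPos_sub_riemannZeta_one {x : ℝ} (hx : 0 < x) :
    hurwitzZetaPos x 1 - riemannZeta 1
      = -Complex.digamma (x : ℂ) - Real.eulerMascheroniConstant := by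
  set D : ℝ → ℂ := fun y => hurwitzZetaPos y 1 - riemannZeta 1 with hD
  have him : ∀ y, 0 < y → (D y).im = 0 := by
    intro y hy
    have h1 := (Complex.continuous_im.tendsto _).comp (tendsto_hurwitzZetaPos_sub_riemannZeta y)
    refine tendsto_nhds_unique h1 (tendsto_const_nhds.congr' ?_)
    filter_upwards [self_mem_nhdsWithin] with σ hσ
    simp only [Function.comp_apply]
    rw [← hurwitzZetaPos_one, Complex.sub_im, (hasSum_hurwitzZetaPos_ofReal hy hσ).2,
      (hasSum_hurwitzZetaPos_ofReal one_pos hσ).2, sub_zero]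
  have hanti : ∀ y, 0 < y → ∀ z, y ≤ z → (D z).re ≤ (D y).re := by
    intro y hy z hyz
    have h1 := (Complex.continuous_re.tendsto _).comp (tendsto_hurwitzZetaPos_sub_riemannZeta y)
    have h2 := (Complex.continuous_re.tendsto _).comp (tendsto_hurwitzZetaPos_sub_riemannZeta z)
    refine le_of_tendsto_of_tendsto h2 h1 ?_
    filter_upwards [self_mem_nhdsWithin] with σ hσ
    have hσ' : 1 < σ := hσ
    simp only [Function.comp_apply, Complex.sub_re]
    refine sub_le_sub_right ?_ _
    refine hasSum_le (fun n => ?_) (hasSum_hurwitzZetaPos_ofReal (hy.trans_le hyz) hσ).1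
      (hasSum_hurwitzZetaPos_ofReal hy hσ).1
    gcongr
  have hadd : ∀ y, 0 < y → D (y + 1) = D y - ((1 / y : ℝ) : ℂ) := by
    intro y hy
    simp only [hD]
    rw [hurwitzZetaPos_add_one hy, Complex.cpow_neg_one]
    push_cast
    ring
  set g₂ : ℝ → ℝ := fun y => -(D y).re - Real.eulerMascheroniConstant with hg₂
  set g₁ : ℝ → ℝ := deriv (Real.log ∘ Real.Gamma) with hg₁
  have h₁ : ∀ y, 0 < y → g₁ (y + 1) = g₁ y + 1 / y := by
    intro y hy
    have h := Complex.digamma_apply_add_one (y : ℂ) fun m h => by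
      have h' : y = -(m : ℝ) := by exact_mod_cast h
      have := m.cast_nonneg (α := ℝ)
      linarith
    rw [← Complex.ofReal_one, ← Complex.ofReal_add, digamma_ofReal (by linarith),
      digamma_ofReal hy] at h
    rw [one_div]
    exact_mod_cast h
  have h₂ : ∀ y, 0 < y → g₂ (y + 1) = g₂ y + 1 / y := by
    intro y hy
    simp only [hg₂, hadd y hy, Complex.sub_re, Complex.ofReal_re]
    ring
  have m₁ : MonotoneOn g₁ (Set.Ioi 0) := by
    refine Real.convexOn_log_Gamma.monotoneOn_deriv fun y hy => ?_
    have hy' : 0 < y := hy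
    refine DifferentiableAt.log (Real.differentiableAt_Gamma fun m h => ?_)
      (Real.Gamma_pos_of_pos hy').ne'
    have := m.cast_nonneg (α := ℝ)
    linarith
  have m₂ : MonotoneOn g₂ (Set.Ioi 0) := fun y hy z _ hyz => by
    have := hanti y hy z hyz
    simp only [hg₂]
    linarith
  have h11 : g₁ 1 = g₂ 1 := by
    have h1 := digamma_ofReal one_pos
    rw [Complex.ofReal_one, Complex.digamma_one] at h1
    have h2 : D 1 = 0 := by simp only [hD, hurwitzZetaPos_one, sub_self]
    simp only [hg₂, h2, Complex.zero_re]
    have h3 : ((-Real.eulerMascheroniConstant : ℝ) : ℂ) = ((g₁ 1 : ℝ) : ℂ) := by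
      rw [← h1]; push_cast; rfl
    have := Complex.ofReal_injective h3
    linarith
  have hg : g₁ x = g₂ x := le_antisymm (le_of_monotoneOn_of_add_one h₁ h₂ m₁ m₂ h11 hx)
    (le_of_monotoneOn_of_add_one h₂ h₁ m₂ m₁ h11.symm hx)
  have hDx : D x = ((D x).re : ℂ) := Complex.ext (by simp) (by simp [him x hx])
  rw [digamma_ofReal hx]
  change D x = -((g₁ x : ℝ) : ℂ) - _
  rw [hg, hDx]
  simp only [hg₂]
  push_cast
  simp

end Digamma

/-! ### Local expansions of the factors -/

/-- Near `1`, `(v - 1) * ζ(v, x) = 1 - ψ(x) (v - 1) + ⋯`. -/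
theorem exists_hasDerivAt_sub_one_mul_hurwitzZetaPos {x : ℝ} (hx : 0 < x) :
    ∃ h : ℂ → ℂ, h 1 = 1 ∧ HasDerivAt h (-Complex.digamma (x : ℂ)) 1 ∧
      ∀ v, v ≠ 1 → h v = (v - 1) * hurwitzZetaPos x v := by
  refine ⟨fun v => riemannZeta₁ v + (v - 1) * (hurwitzZetaPos x v - riemannZeta v), by simp, ?_,
    fun v hv => ?_⟩
  · have h1 : HasDerivAt riemannZeta₁ (Real.eulerMascheroniConstant : ℂ) 1 := by
      rw [← deriv_riemannZeta₁_one]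
      exact (differentiable_riemannZeta₁ 1).hasDerivAt
    have h2 := ((hasDerivAt_id' (1 : ℂ)).sub_const 1).fun_mul
      (differentiable_hurwitzZetaPos_sub_riemannZeta x 1).hasDerivAt
    refine (h1.fun_add h2).congr_deriv ?_
    rw [hurwitzZetaPos_sub_riemannZeta_one hx]
    ring
  · have : v - 1 ≠ 0 := sub_ne_zero.mpr hv
    simp only [riemannZeta_eq_inv_sub_mul hv]
    field_simp
    ring

/-- Near `-j`, `(v + j) * Γ(v) = (-1) ^ j / j! * (1 + (H_j - γ) (v + j) + ⋯)`. -/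
theorem exists_hasDerivAt_add_mul_Gamma (j : ℕ) :
    ∃ g : ℂ → ℂ, g (-j) = (-1) ^ j / (j.factorial : ℂ) ∧
      HasDerivAt g ((-1) ^ j / (j.factorial : ℂ)
        * (((harmonic j : ℚ) : ℂ) - Real.eulerMascheroniConstant)) (-j) ∧
      ∀ᶠ v in 𝓝[≠] (-j : ℂ), g v = (v + j) * Complex.Gamma v := by
  induction j with
  | zero =>
    refine ⟨fun v => Complex.Gamma (v + 1), by simp, ?_, ?_⟩
    · have h1 := Complex.hasDerivAt_Gamma_one
      rw [← zero_add (1 : ℂ)] at h1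
      have := HasDerivAt.comp_add_const (0 : ℂ) 1 h1
      simpa using this
    · simp only [Nat.cast_zero, neg_zero, add_zero]
      filter_upwards [self_mem_nhdsWithin] with v hv
      exact Complex.Gamma_add_one v hv
  | succ j ih =>
    obtain ⟨g, hg0, hgd, hg⟩ := ih
    have hj : (-((j + 1 : ℕ) : ℂ)) ≠ 0 := neg_ne_zero.mpr (Nat.cast_ne_zero.mpr j.succ_ne_zero)
    have hj1 : -((j + 1 : ℕ) : ℂ) + 1 = -j := by push_cast; ring
    have hj2 : ((j.factorial : ℕ) : ℂ) ≠ 0 := Nat.cast_ne_zero.mpr j.factorial_ne_zero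
    have hj3 : (j : ℂ) + 1 ≠ 0 := Nat.cast_add_one_ne_zero j
    -- From `Γ(v) = Γ(v + 1) / v`; the derivative of `1 / v` supplies the new harmonic term `1 / (j
    -- + 1)`.
    refine ⟨fun v => g (v + 1) / v, ?_, ?_, ?_⟩
    · simp only [hj1, hg0, Nat.factorial_succ, pow_succ]
      push_cast
      field_simp
    · have h1 : HasDerivAt (fun v => g (v + 1)) _ (-((j + 1 : ℕ) : ℂ)) :=
        HasDerivAt.comp_add_const _ 1 (hj1 ▸ hgd)
      refine (h1.fun_div (hasDerivAt_id' _) hj).congr_deriv ?_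
      simp only [hj1, hg0, Nat.factorial_succ, pow_succ, harmonic_succ]
      push_cast
      field_simp
      ring
    · have ht : Tendsto (fun v : ℂ => v + 1) (𝓝[≠] (-((j + 1 : ℕ) : ℂ))) (𝓝[≠] (-j : ℂ)) := by
        refine tendsto_nhdsWithin_iff.mpr ⟨?_, ?_⟩
        · rw [← hj1]
          exact ((continuous_add_const 1).tendsto _).mono_left nhdsWithin_le_nhds
        · filter_upwards [self_mem_nhdsWithin] with v hv h
          refine hv ?_
          rw [Set.mem_singleton_iff] at h ⊢
          rw [← hj1] at h
          exact add_right_cancel h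
      filter_upwards [ht.eventually hg, nhdsWithin_le_nhds (isOpen_ne.mem_nhds hj)] with v hv hv0
      rw [hv, Complex.Gamma_add_one v hv0]
      push_cast
      field_simp
      ring

/-! ### Laurent data of the Mellin transform at its poles -/

section Poles

theorem hasDerivAt_sub_mul {F : ℂ → ℂ} {w₀ : ℂ} (hF : DifferentiableAt ℂ F w₀) :
    HasDerivAt (fun w => (w - w₀) * F w) (F w₀) w₀ := by
  refine (((hasDerivAt_id' w₀).sub_const w₀).fun_mul hF.hasDerivAt).congr_deriv ?_
  simp

theorem differentiableAt_comp_add_one {F : ℂ → ℂ} {w v : ℂ} (h : w + 1 = v)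
    (hF : DifferentiableAt ℂ F v) : DifferentiableAt ℂ (fun w => F (w + 1)) w := by
  subst h
  exact hF.comp w (by fun_prop)

theorem tendsto_add_one_punctured {w v : ℂ} (h : w + 1 = v) :
    Tendsto (fun z : ℂ => z + 1) (𝓝[≠] w) (𝓝[≠] v) := by
  subst h
  refine tendsto_nhdsWithin_iff.mpr
    ⟨((continuous_add_const 1).tendsto _).mono_left nhdsWithin_le_nhds, ?_⟩
  filter_upwards [self_mem_nhdsWithin] with z hz h
  exact hz (add_right_cancel h)

theorem differentiableAt_riemannZeta_shift {s w : ℂ} (h : w + 1 - s ≠ 1) :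
    DifferentiableAt ℂ (fun w => riemannZeta (w + 1 - s)) w :=
  (differentiableAt_riemannZeta h).comp w (f := fun w => w + 1 - s) (by fun_prop)

/-- The coefficient of `t ^ k` in the expansion of `t * lambertExp s x t`. -/
noncomputable def lambertCoeff (s : ℂ) (x : ℝ) (k : ℕ) : ℂ :=
  (-1) ^ k / (k.factorial : ℂ) * (bernoulliFun k x : ℂ) * riemannZeta (1 - s - k)

/-- The pole is at most simple, as `ζ(w + 1 - s)` is regular there. It comes from `ζ(w + 1, x)` when
`k = 0` and from `Γ(w + 1)` when `k ≥ 1`. -/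
theorem lambertMellin_at_neg_nat {x : ℝ} (hx : 0 < x) {s : ℂ} {k : ℕ} (hs : s ≠ -(k : ℂ)) :
    ∃ H : ℂ → ℂ, H (-k) = 0 ∧ HasDerivAt H (lambertCoeff s x k) (-k) ∧
      ∀ᶠ w in 𝓝[≠] (-k : ℂ), H w = (w - -k) ^ 2 * lambertMellin s x w := by
  have hζ : DifferentiableAt ℂ (fun w => riemannZeta (w + 1 - s)) (-(k : ℂ)) :=
    differentiableAt_riemannZeta_shift fun h => hs (by linear_combination -h)
  rcases k with _ | j
  · obtain ⟨h, h1, hd, hh⟩ := exists_hasDerivAt_sub_one_mul_hurwitzZetaPos hx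
    have e : -((0 : ℕ) : ℂ) + 1 = 1 := by simp
    have hF : DifferentiableAt ℂ (fun w => Complex.Gamma (w + 1) * h (w + 1)
        * riemannZeta (w + 1 - s)) (-((0 : ℕ) : ℂ)) :=
      ((differentiableAt_comp_add_one e Complex.hasDerivAt_Gamma_one.differentiableAt).fun_mul
        (differentiableAt_comp_add_one e hd.differentiableAt)).fun_mul hζ
    refine ⟨_, by simp, (hasDerivAt_sub_mul hF).congr_deriv ?_, ?_⟩
    · simp [lambertCoeff, h1]
    · filter_upwards [self_mem_nhdsWithin] with w hw
      rw [hh (w + 1) fun h => hw (by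
        rw [Set.mem_singleton_iff]; push_cast; linear_combination h), lambertMellin]
      push_cast
      ring
  · obtain ⟨g, hg0, hgd, hg⟩ := exists_hasDerivAt_add_mul_Gamma j
    have e : -((j + 1 : ℕ) : ℂ) + 1 = -j := by push_cast; ring
    have hj : (-j : ℂ) ≠ 1 := fun h => by
      have := congrArg Complex.re h
      simp at this
      linarith [j.cast_nonneg (α := ℝ)]
    have hF : DifferentiableAt ℂ (fun w => g (w + 1) * hurwitzZetaPos x (w + 1)
        * riemannZeta (w + 1 - s)) (-((j + 1 : ℕ) : ℂ)) :=
      ((differentiableAt_comp_add_one e hgd.differentiableAt).fun_mul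
        (differentiableAt_comp_add_one e (differentiableAt_hurwitzZetaPos hj))).fun_mul hζ
    refine ⟨_, by simp, (hasDerivAt_sub_mul hF).congr_deriv ?_, ?_⟩
    · have h3 : (j : ℂ) + 1 ≠ 0 := Nat.cast_add_one_ne_zero j
      have h4 : (j.factorial : ℂ) ≠ 0 := Nat.cast_ne_zero.mpr j.factorial_ne_zero
      rw [e, hg0, hurwitzZetaPos_neg_nat hx, lambertCoeff, Nat.factorial_succ, pow_succ]
      rw [show 1 - s - ((j + 1 : ℕ) : ℂ) = -j - s by push_cast; ring]
      push_cast
      field_simp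
    · filter_upwards [(tendsto_add_one_punctured e).eventually hg] with w hw
      rw [hw, lambertMellin]
      push_cast
      ring

/-- The pole comes from `ζ(w + 1 - s)` alone; excluding nonpositive integers keeps the other two
factors regular. -/
theorem lambertMellin_at_main {x : ℝ} {s : ℂ} (hs : ∀ n : ℕ, s ≠ -(n : ℂ)) :
    ∃ H : ℂ → ℂ, H s = 0 ∧ HasDerivAt H (Complex.Gamma (1 + s) * hurwitzZetaPos x (1 + s)) s ∧
      ∀ᶠ w in 𝓝[≠] s, H w = (w - s) ^ 2 * lambertMellin s x w := by
  have hF : DifferentiableAt ℂ (fun w => Complex.Gamma (w + 1) * hurwitzZetaPos x (w + 1)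
      * riemannZeta₁ (w + 1 - s)) s := by
    refine DifferentiableAt.fun_mul (DifferentiableAt.fun_mul
      (differentiableAt_comp_add_one rfl (Complex.differentiableAt_Gamma _ fun m h => ?_))
      (differentiableAt_comp_add_one rfl (differentiableAt_hurwitzZetaPos fun h => ?_)))
      (by fun_prop)
    · exact hs (m + 1) (by push_cast; linear_combination h)
    · exact hs 0 (by push_cast; linear_combination h)
  refine ⟨_, by simp, (hasDerivAt_sub_mul hF).congr_deriv ?_, ?_⟩
  · rw [add_sub_cancel_left, riemannZeta₁_one, add_comm s 1]
    ring
  · filter_upwards [self_mem_nhdsWithin] with w hw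
    have h1 : w - s ≠ 0 := sub_ne_zero.mpr hw
    have h2 : w + 1 - s ≠ 1 := fun h => h1 (by linear_combination h)
    rw [lambertMellin, riemannZeta_eq_inv_sub_mul h2, show w + 1 - s - 1 = w - s by ring]
    field_simp

theorem lambertMellin_at_zero {x : ℝ} (hx : 0 < x) :
    ∃ H : ℂ → ℂ, H 0 = 1 ∧ HasDerivAt H (-Complex.digamma (x : ℂ)) 0 ∧
      ∀ᶠ w in 𝓝[≠] (0 : ℂ), H w = (w - 0) ^ 2 * lambertMellin 0 x w := by
  obtain ⟨h, h1, hd, hh⟩ := exists_hasDerivAt_sub_one_mul_hurwitzZetaPos hx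
  have e : (0 : ℂ) + 1 = 1 := zero_add 1
  have dΓ := HasDerivAt.comp_add_const (0 : ℂ) 1 (e.symm ▸ Complex.hasDerivAt_Gamma_one)
  have dh := HasDerivAt.comp_add_const (0 : ℂ) 1 (e.symm ▸ hd)
  have dζ : HasDerivAt (fun w => riemannZeta₁ (w + 1)) (Real.eulerMascheroniConstant : ℂ) 0 := by
    refine HasDerivAt.comp_add_const (0 : ℂ) 1 ?_
    rw [e, ← deriv_riemannZeta₁_one]
    exact (differentiable_riemannZeta₁ 1).hasDerivAt
  -- The logarithmic derivatives are `-γ`, `-ψ(x)` and `γ`, so Euler's constant cancels.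
  refine ⟨_, ?_, ((dΓ.fun_mul dh).fun_mul dζ).congr_deriv ?_, ?_⟩
  · simp [h1]
  · simp [h1]
  · filter_upwards [self_mem_nhdsWithin] with w hw
    have h2 : w + 1 ≠ 1 := fun h => hw (by
      rw [Set.mem_singleton_iff]; linear_combination h)
    have h3 : w ≠ 0 := hw
    rw [hh _ h2, lambertMellin, sub_zero, sub_zero, riemannZeta_eq_inv_sub_mul h2, add_sub_cancel_right]
    field_simp

theorem lambertMellin_at_neg_succ {x : ℝ} (hx : 0 < x) (j : ℕ) :
    ∃ H : ℂ → ℂ, H (-((j + 1 : ℕ) : ℂ))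
        = (-1) ^ j / (j.factorial : ℂ) * (-(bernoulliFun (j + 1) x : ℂ) / (j + 1)) ∧
      HasDerivAt H ((-1) ^ j / (j.factorial : ℂ) * (deriv (hurwitzZetaPos x) (-j)
        - ((harmonic j : ℚ) : ℂ) * ((bernoulliFun (j + 1) x : ℂ) / (j + 1))))
        (-((j + 1 : ℕ) : ℂ)) ∧
      ∀ᶠ w in 𝓝[≠] (-((j + 1 : ℕ) : ℂ)),
        H w = (w - -((j + 1 : ℕ) : ℂ)) ^ 2 * lambertMellin (-((j + 1 : ℕ) : ℂ)) x w := by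
  obtain ⟨g, hg0, hgd, hg⟩ := exists_hasDerivAt_add_mul_Gamma j
  have e : -((j + 1 : ℕ) : ℂ) + 1 = -j := by push_cast; ring
  have hj : (-j : ℂ) ≠ 1 := fun h => by
    have := congrArg Complex.re h
    simp at this
    linarith [j.cast_nonneg (α := ℝ)]
  have dg := HasDerivAt.comp_add_const (-((j + 1 : ℕ) : ℂ)) 1 (e.symm ▸ hgd)
  have dz := HasDerivAt.comp_add_const (-((j + 1 : ℕ) : ℂ)) 1
    (e.symm ▸ (differentiableAt_hurwitzZetaPos (x := x) hj).hasDerivAt)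
  have dζ : HasDerivAt (fun w => riemannZeta₁ (w + (1 + ((j + 1 : ℕ) : ℂ))))
      (Real.eulerMascheroniConstant : ℂ) (-((j + 1 : ℕ) : ℂ)) := by
    refine HasDerivAt.comp_add_const _ _ ?_
    rw [show -((j + 1 : ℕ) : ℂ) + (1 + ((j + 1 : ℕ) : ℂ)) = 1 by ring, ← deriv_riemannZeta₁_one]
    exact (differentiable_riemannZeta₁ 1).hasDerivAt
  have e2 : -((j + 1 : ℕ) : ℂ) + (1 + ((j + 1 : ℕ) : ℂ)) = 1 := by ring
  -- The double pole joins the pole of `Γ` with that of `ζ`; the `-γ` of the former cancels the `γ`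
  -- of the latter, leaving the harmonic number.
  refine ⟨_, ?_, ((dg.fun_mul dz).fun_mul dζ).congr_deriv ?_, ?_⟩
  · simp only [e, e2, hg0, hurwitzZetaPos_neg_nat hx, riemannZeta₁_one, mul_one]
  · simp only [e, e2, hg0, hurwitzZetaPos_neg_nat hx, riemannZeta₁_one, mul_one]
    ring
  · filter_upwards [(tendsto_add_one_punctured e).eventually hg, self_mem_nhdsWithin] with w hw hw0
    have h1 : w + ((j + 1 : ℕ) : ℂ) ≠ 0 := fun h => hw0 (by
      rw [Set.mem_singleton_iff]; linear_combination h)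
    have h2 : w + (1 + ((j + 1 : ℕ) : ℂ)) ≠ 1 := fun h => h1 (by linear_combination h)
    have h3 : w + 1 - -((j + 1 : ℕ) : ℂ) = w + (1 + ((j + 1 : ℕ) : ℂ)) := by ring
    rw [hw, lambertMellin, h3, riemannZeta_eq_inv_sub_mul h2,
      show w + (1 + ((j + 1 : ℕ) : ℂ)) - 1 = w + ((j + 1 : ℕ) : ℂ) by ring,
      show w + 1 + (j : ℂ) = w + ((j + 1 : ℕ) : ℂ) by push_cast; ring, sub_neg_eq_add]
    field_simp

end Poles

/-! ### Expansions in `t` with explicit coefficients -/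

section Expansions

theorem sum_ite_neg_natCast_eq (c : ℕ → ℂ) {k N : ℕ} (hk : k < N) :
    ∑ i ∈ Finset.range N, (if (-(k : ℂ)) = -(i : ℂ) then c i else 0) = c k := by
  simp only [neg_inj, Nat.cast_inj, Finset.sum_ite_eq, Finset.mem_range, hk, if_true]

theorem lambertExp_expansion_of_ne {x : ℝ} (hx : 0 < x) {s : ℂ} (hs : ∀ n : ℕ, s ≠ -(n : ℂ))
    (N : ℕ) :
    (fun t : ℝ => t * lambertExp s x t
        - Complex.Gamma (1 + s) * hurwitzZetaPos x (1 + s) * (t : ℂ) ^ (-s)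
      - ∑ k ∈ Finset.range N, lambertCoeff s x k * (t : ℂ) ^ k) =O[𝓝[>] 0] fun t : ℝ => t ^ N := by
  -- The order is raised until `s` lies in the half-plane `Re w > -M` where coefficients can be read
  -- off; the surplus terms are discarded at the end.
  obtain ⟨n, hn⟩ := exists_nat_gt (-s.re)
  set M := max N n with hM
  have hnM : (n : ℝ) ≤ M := by exact_mod_cast le_max_right N n
  refine isBigO_sub_sum_pow_of_le (le_max_left N n) ?_
  obtain ⟨α, β, c, -, hO⟩ := powLogExpansion_id_mul_lambertExp s hx M
  obtain ⟨H, hH0, hHd, hH⟩ := lambertMellin_at_main (x := x) hs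
  obtain ⟨e1, e2⟩ := expansion_coeff_lambertExp hx hO (by linarith) hHd hH
  rw [hH0, if_pos rfl] at e1
  rw [if_pos rfl, Finset.sum_eq_zero fun i _ => if_neg (hs i), add_zero] at e2
  have hβ : β = 0 := neg_eq_zero.mp e1.symm
  have hc : ∀ k < M, c k = lambertCoeff s x k := by
    intro k hk
    obtain ⟨K, -, hKd, hK⟩ := lambertMellin_at_neg_nat hx (hs k)
    have h := (expansion_coeff_lambertExp hx hO (by simpa using hk) hKd hK).2
    rw [sum_ite_neg_natCast_eq c hk, if_neg fun h => hs k h.symm, zero_add] at h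
    exact h.symm
  refine hO.congr_left fun t => ?_
  rw [hβ, ← e2, Finset.sum_congr rfl fun k hk => by rw [hc k (Finset.mem_range.mp hk)]]
  ring

/-- Here `t ^ (-s) = t ^ m` collides with a term of the power sum. Only `α + c m` is determined, by
the residue, while the double-pole coefficient gives `-β`. -/
theorem lambertExp_expansion_of_eq {x : ℝ} (hx : 0 < x) {m : ℕ} {H : ℂ → ℂ} {d : ℂ}
    (hHd : HasDerivAt H d (-m))
    (hH : ∀ᶠ w in 𝓝[≠] (-m : ℂ), H w = (w - -m) ^ 2 * lambertMellin (-m) x w) (N : ℕ) :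
    (fun t : ℝ => t * lambertExp (-m) x t - (d - H (-m) * (Real.log t : ℂ)) * (t : ℂ) ^ m
      - ∑ k ∈ (Finset.range N).erase m, lambertCoeff (-m) x k * (t : ℂ) ^ k)
      =O[𝓝[>] 0] fun t : ℝ => t ^ N := by
  set c' : ℕ → ℂ := Function.update (lambertCoeff (-m) x) m 0 with hc'
  have hsum : ∀ (K : ℕ) (t : ℝ), ∑ k ∈ (Finset.range K).erase m,
      lambertCoeff (-m) x k * (t : ℂ) ^ k = ∑ k ∈ Finset.range K, c' k * (t : ℂ) ^ k := by
    intro K t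
    rw [← Finset.sum_erase (Finset.range K) (a := m) (by simp [hc'])]
    refine Finset.sum_congr rfl fun k hk => ?_
    rw [hc', Function.update_of_ne (Finset.ne_of_mem_erase hk)]
  simp_rw [hsum]
  set M := max N (m + 1) with hM
  have hmM : m < M := Nat.lt_of_succ_le (le_max_right N (m + 1))
  refine isBigO_sub_sum_pow_of_le (le_max_left N (m + 1)) ?_
  obtain ⟨α, β, c, -, hO⟩ := powLogExpansion_id_mul_lambertExp (-m) hx M
  obtain ⟨e1, e2⟩ := expansion_coeff_lambertExp hx hO (by simpa using hmM) hHd hH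
  rw [if_pos rfl] at e1
  rw [if_pos rfl, sum_ite_neg_natCast_eq c hmM] at e2
  have hc : ∀ k < M, k ≠ m → c k = lambertCoeff (-m) x k := by
    intro k hk hkm
    have hne : (-m : ℂ) ≠ -(k : ℂ) := fun h => hkm (by
      rw [neg_inj, Nat.cast_inj] at h; exact h.symm)
    obtain ⟨K, -, hKd, hK⟩ := lambertMellin_at_neg_nat hx hne
    have h := (expansion_coeff_lambertExp hx hO (by simpa using hk) hKd hK).2
    rw [sum_ite_neg_natCast_eq c hk, if_neg hne.symm, zero_add] at h
    exact h.symm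
  refine hO.congr_left fun t => ?_
  rw [← hsum, ← Finset.add_sum_erase _ _ (Finset.mem_range.mpr hmM),
    Finset.sum_congr rfl fun k hk => by
      rw [hc k (Finset.mem_range.mp (Finset.mem_of_mem_erase hk)) (Finset.ne_of_mem_erase hk)],
    neg_neg, Complex.cpow_natCast, e1, e2]
  ring

end Expansions

/-! ### Return from `t` to `q` -/

section Transport

theorem lambertTerm_eq {q : ℝ} (hq : 0 < q) (s : ℂ) (x : ℝ) (k : ℕ) :
    lambertTerm q s x k = ((k + 1 : ℕ) : ℂ) ^ s * (lambertWeight k x (-Real.log q) : ℂ) := by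
  have h1 : q ^ (((k + 1 : ℕ) : ℝ) * x)
      = Real.exp (-((k + 1 : ℕ) : ℝ) * (x * -Real.log q)) := by
    rw [Real.rpow_def_of_pos hq]
    congr 1
    ring
  have h2 : q ^ (k + 1) = Real.exp (-((k + 1 : ℕ) : ℝ) * -Real.log q) := by
    rw [← Real.rpow_natCast, Real.rpow_def_of_pos hq]
    congr 1
    ring
  rw [lambertTerm, lambertWeight, mul_div_assoc, h1, ← h2]
  push_cast
  rfl

theorem lambertSeries_eq {q : ℝ} (hq : 0 < q) (s : ℂ) (x : ℝ) :
    lambertSeries q s x = lambertExp s x (-Real.log q) :=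
  tsum_congr fun k => lambertTerm_eq hq s x k

theorem summable_lambertTerm {x : ℝ} (hx : 0 < x) (s : ℂ) {q : ℝ} (hq : 0 ≤ q) (hq1 : q < 1) :
    Summable (lambertTerm q s x) := by
  rcases hq.eq_or_lt with rfl | hq
  · refine summable_zero.congr fun k => ?_
    have h : ((k + 1 : ℕ) : ℝ) * x ≠ 0 := by positivity
    rw [lambertTerm, Real.zero_rpow h]
    simp
  · exact (summable_lambertExp s hx (neg_pos.mpr (Real.log_neg hq hq1))).congr
      fun k => (lambertTerm_eq hq s x k).symm

/-- The factor `t = -log q` carried so far is divided out, which lowers the error exponent to `N -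
1`; the integer power covers `N = 0`. -/
theorem isBigO_log_zpow_of_isBigO {F g : ℝ → ℂ} {N : ℕ} (hg : g =O[𝓝[>] 0] fun t : ℝ => t ^ N)
    (h : ∀ q : ℝ, 0 < q → q < 1 → -(Real.log q : ℂ) * F q = g (-Real.log q)) :
    F =O[𝓝[<] 1] fun q : ℝ => Real.log q ^ ((N : ℤ) - 1) := by
  have hq : ∀ᶠ q : ℝ in 𝓝[<] 1, 0 < q ∧ q < 1 := Ioo_mem_nhdsLT one_pos
  have ht : Tendsto (fun q : ℝ => -Real.log q) (𝓝[<] 1) (𝓝[>] 0) := by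
    refine tendsto_nhdsWithin_iff.mpr ⟨?_, ?_⟩
    · have : Tendsto (fun q : ℝ => -Real.log q) (𝓝 1) (𝓝 (-Real.log 1)) :=
        (Real.continuousAt_log one_ne_zero).neg
      rw [Real.log_one, neg_zero] at this
      exact this.mono_left nhdsWithin_le_nhds
    · filter_upwards [hq] with q hq
      exact neg_pos.mpr (Real.log_neg hq.1 hq.2)
  have h1 : (fun q : ℝ => ((-Real.log q : ℝ) : ℂ)⁻¹) =O[𝓝[<] 1] fun q : ℝ => (Real.log q)⁻¹ :=
    IsBigO.of_bound 1 (Eventually.of_forall fun q => by simp)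
  have h2 : (fun q : ℝ => (-Real.log q) ^ N) =O[𝓝[<] 1] fun q : ℝ => Real.log q ^ N :=
    IsBigO.of_bound 1 (Eventually.of_forall fun q => by simp)
  refine (((hg.comp_tendsto ht).trans h2).mul h1).congr' ?_ ?_
  · filter_upwards [hq] with q hq
    have hl : (Real.log q : ℂ) ≠ 0 := by exact_mod_cast (Real.log_neg hq.1 hq.2).ne
    simp only [Function.comp_apply]
    rw [← h q hq.1 hq.2]
    push_cast
    field_simp
  · filter_upwards [hq] with q hq
    rw [zpow_sub₀ (Real.log_neg hq.1 hq.2).ne, zpow_natCast, zpow_one, div_eq_mul_inv]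

/-- `-log q` times the `k`-th term of the expansion in powers of `log q`. -/
theorem lambertCoeff_mul_neg_pow (s : ℂ) (x : ℝ) (k : ℕ) {l : ℂ} (hl : l ≠ 0) :
    l * (riemannZeta (1 - s - k) / (k.factorial : ℂ) * (bernoulliFun k x : ℂ) * l ^ ((k : ℤ) - 1))
      = lambertCoeff s x k * (-l) ^ k := by
  rw [zpow_sub₀ hl, zpow_natCast, zpow_one, lambertCoeff, neg_pow l]
  have : ((-1 : ℂ) ^ k) * (-1) ^ k = 1 := by rw [← mul_pow]; simp
  field_simp
  linear_combination -(riemannZeta (1 - s - k) * (bernoulliFun k x : ℂ) / (k.factorial : ℂ)) * this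

end Transport

theorem mainTheorem1 (x : ℝ) (hx : 0 < x) :
    -- convergence of the Lambert series
    (∀ (s : ℂ) (q : ℝ), 0 ≤ q → q < 1 → Summable (lambertTerm q s x)) ∧
    -- `s ≠ 0, -1, -2, …`
    (∀ s : ℂ, (∀ n : ℕ, s ≠ -(n : ℂ)) → ∀ N : ℕ,
      (fun q : ℝ => lambertSeries q s x
          - (Complex.Gamma (1 + s) * hurwitzZetaPos x (1 + s)
                / ((Real.log (1 / q) : ℝ) : ℂ) ^ (1 + s)
              - ∑ k ∈ Finset.range N,
                  riemannZeta (1 - s - (k : ℂ)) / (k.factorial : ℂ) * (bernoulliFun k x : ℂ)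
                    * ((Real.log q : ℝ) : ℂ) ^ ((k : ℤ) - 1)))
        =O[𝓝[<] (1 : ℝ)] (fun q : ℝ => Real.log q ^ ((N : ℤ) - 1))) ∧
    -- `s = 0`
    (∀ N : ℕ, 1 ≤ N →
      (fun q : ℝ => lambertSeries q 0 x
          - ((Complex.digamma (x : ℂ) + ((Real.log (Real.log (1 / q)) : ℝ) : ℂ))
                / ((Real.log q : ℝ) : ℂ)
              - ∑ k ∈ Finset.Ico 1 N,
                  riemannZeta (1 - (k : ℂ)) / (k.factorial : ℂ) * (bernoulliFun k x : ℂ)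
                    * ((Real.log q : ℝ) : ℂ) ^ ((k : ℤ) - 1)))
        =O[𝓝[<] (1 : ℝ)] (fun q : ℝ => Real.log q ^ ((N : ℤ) - 1))) ∧
    -- `s = -m = -1, -2, -3, …`
    (∀ m : ℕ, 1 ≤ m → ∀ N : ℕ,
      (fun q : ℝ => lambertSeries q (-(m : ℂ)) x
          - (((m : ℂ) * deriv (hurwitzZetaPos x) (1 - (m : ℂ))
                + (((Real.log (Real.log (1 / q)) : ℝ) : ℂ) - ((harmonic (m - 1) : ℚ) : ℂ))
                  * (bernoulliFun m x : ℂ))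
                * (((Real.log q : ℝ) : ℂ) ^ (m - 1) / (m.factorial : ℂ))
              - ∑ k ∈ (Finset.range N).erase m,
                  riemannZeta (1 + (m : ℂ) - (k : ℂ)) / (k.factorial : ℂ)
                    * (bernoulliFun k x : ℂ) * ((Real.log q : ℝ) : ℂ) ^ ((k : ℤ) - 1)))
        =O[𝓝[<] (1 : ℝ)] (fun q : ℝ => Real.log q ^ ((N : ℤ) - 1))) := by
  refine ⟨fun s q hq hq1 => summable_lambertTerm hx s hq hq1, fun s hs N => ?_,
    fun N hN => ?_, fun m hm N => ?_⟩
  · refine isBigO_log_zpow_of_isBigO (lambertExp_expansion_of_ne hx hs N) fun q hq hq1 => ?_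
    have hl : (Real.log q : ℂ) ≠ 0 := by exact_mod_cast (Real.log_neg hq hq1).ne
    rw [lambertSeries_eq hq, one_div q, Real.log_inv, Complex.ofReal_neg,
      Finset.sum_congr rfl fun k _ => (lambertCoeff_mul_neg_pow s x k hl).symm,
      ← Finset.mul_sum, Complex.cpow_add _ _ (neg_ne_zero.mpr hl), Complex.cpow_one, Complex.cpow_neg]
    field_simp
    ring
  · obtain ⟨H, hH0, hHd, hH⟩ := lambertMellin_at_zero hx
    have e : (0 : ℂ) = -((0 : ℕ) : ℂ) := by simp
    have hO := lambertExp_expansion_of_eq (m := 0) hx (e ▸ hHd) (e ▸ hH) N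
    refine isBigO_log_zpow_of_isBigO hO fun q hq hq1 => ?_
    have hl : (Real.log q : ℂ) ≠ 0 := by exact_mod_cast (Real.log_neg hq hq1).ne
    have hset : (Finset.range N).erase 0 = Finset.Ico 1 N := by
      ext k
      simp only [Finset.mem_erase, Finset.mem_range, Finset.mem_Ico]
      omega
    rw [lambertSeries_eq hq, one_div q, Real.log_inv, Complex.ofReal_neg, hset, ← e, hH0,
      Finset.sum_congr rfl fun k _ => (lambertCoeff_mul_neg_pow 0 x k hl).symm,
      ← Finset.mul_sum]
    simp only [sub_zero]
    field_simp
    ring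
  · obtain ⟨j, rfl⟩ : ∃ j, m = j + 1 := ⟨m - 1, by omega⟩
    obtain ⟨H, hH0, hHd, hH⟩ := lambertMellin_at_neg_succ hx j
    refine isBigO_log_zpow_of_isBigO (lambertExp_expansion_of_eq hx hHd hH N) fun q hq hq1 => ?_
    have hl : (Real.log q : ℂ) ≠ 0 := by exact_mod_cast (Real.log_neg hq hq1).ne
    have h1 : (1 : ℂ) - ((j + 1 : ℕ) : ℂ) = -j := by push_cast; ring
    have hpow : ((-1 : ℂ) ^ j) * (-1) ^ j = 1 := by rw [← mul_pow]; simp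
    -- The sign of `t ^ (j + 1) = (-log q) ^ (j + 1)` absorbs the `(-1) ^ j` of the Gamma residue.
    have h3 : (-(Real.log q : ℂ)) ^ (j + 1) * ((-1) ^ j / (j.factorial : ℂ))
        = -((Real.log q : ℂ) ^ j * (Real.log q : ℂ)) / (j.factorial : ℂ) := by
      rw [neg_pow, pow_succ (-1 : ℂ), ← pow_succ]
      linear_combination -(Real.log q : ℂ) ^ (j + 1) / (j.factorial : ℂ) * hpow
    have h4 : ((j : ℂ) + 1) * ((j : ℂ) + 1)⁻¹ = 1 :=
      mul_inv_cancel₀ (Nat.cast_add_one_ne_zero j)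
    rw [lambertSeries_eq hq, one_div q, Real.log_inv, Complex.ofReal_neg, hH0, h1, Nat.add_sub_cancel,
      Finset.sum_congr rfl fun k _ => (lambertCoeff_mul_neg_pow (-((j + 1 : ℕ) : ℂ)) x k hl).symm,
      ← Finset.mul_sum, sub_neg_eq_add, Nat.factorial_succ]
    push_cast
    rw [div_eq_mul_inv _ (((j : ℂ) + 1) * (j.factorial : ℂ)), mul_inv]
    linear_combination (deriv (hurwitzZetaPos x) (-j) + ((Real.log (-Real.log q) : ℂ)
      - ((harmonic j : ℚ) : ℂ)) * ((bernoulliFun (j + 1) x : ℂ) / (j + 1))) * h3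
      + (Real.log q : ℂ) ^ j * (Real.log q : ℂ) * deriv (hurwitzZetaPos x) (-j)
        / (j.factorial : ℂ) * h4
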